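/- Identify Euclidean 4-space $E^4$ with the quaternions $\mathbb H$ via $(p_0,p_1,p_2,p_3)\mapsto p_0+p_1\mathbf i+p_2\mathbf j+p_3\mathbf k$. A line $\ell\subset E^4$ with direction vector $L\neq 0$ and pedal point $F$ with respect to the origin ($F\in\ell$, $\langle F,L\rangle=0$) has the homogeneous coordinates $(L,m)\mathbb R$ with $m=\widetilde L\circ F$, where $\widetilde L$ is the conjugate of $L$. Let $\ell_1,\ell_2$ be two skew (i.e. not coplanar) lines that are orthogonal to the $x_0$-direction, with coordinates $(l_1,m_1)\mathbb R$ and $(l_2,m_2)\mathbb R$, and let $\Gamma=\Gamma(\ell_1,\ell_2)$ be the ruled 2-surface whose rulings are all lines with coordinates $(al_1+bl_2,\;am_1+bm_2)\mathbb R$, $(a,b)\in\mathbb R^2\setminus\{(0,0)\}$. The line-symmetric motion with basic surface $\Gamma$ consists of the displacements $\kappa_\ell\circ\rho_0$, where $\ell$ runs through the rulings of $\Gamma$, $\kappa_\ell$ is the reflection in the line $\ell$ and $\rho_0$ is the reflection in the hyperplane $x_0=0$. A one-parameter motion is the set $S$ of displacements (orientation-preserving isometries of $E^4$) run through by a non-constant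 continuous curve of displacements. It is a circular Darboux 2-motion if the trajectory $\{g(x): g\in S\}$ of every point $x$ is a circle (radius $0$ being allowed); it is spherical if some point has a constant trajectory, and a pure translation if all displacements in $S$ have the same linear part. **Theorem.** (a) For all skew lines $\ell_1,\ell_2$ orthogonal to the $x_0$-direction, the line-symmetric motion with basic surface $\Gamma(\ell_1,\ell_2)$ is a circular Darboux 2-motion that is neither spherical nor a pure translation. (b) Conversely, every circular Darboux 2-motion of $E^4$ that is neither spherical nor a pure translation is, with respect to suitable Cartesian frames (of either handedness) of the fixed and of the moving space, the line-symmetric motion with basic surface $\Gamma(\ell_1,\ell_2)$ for some skew lines $\ell_1,\ell_2$ orthogonal to the $x_0$-direction: there are isometries $\varphi,\psi$ of $E^4$ with $S=\{\varphi\circ\kappa_\ell\circ\rho_0\circ\psi:\ \ell \text{ a ruling of }\Gamma(\ell_1,\ell_2)\}$. If the trajectory of every point under a one-parameter motion $S$ that is neither spherical nor a pure translation is only assumed to be contained in a circle, then $S$ is, in the same sense, a subset of such a line-symmetric motion. -/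

import Mathlib

/-- Euclidean 4-space. The point `(p₀, p₁, p₂, p₃)` is identified with the quaternion
`p₀ + p₁ i + p₂ j + p₃ k`; Mathlib's norm and inner product on the quaternions are the
Euclidean ones, and the coordinate `x₀` is the real part. -/
abbrev E4 : Type := Quaternion ℝ

/-- `ℓ` belongs to the set of those lines of `E4` that are orthogonal to the `x₀`-direction. -/
def IsLineOrthX0 (ℓ : AffineSubspace ℝ E4) : Prop :=
  (ℓ : Set E4).Nonempty ∧ Module.finrank ℝ ℓ.direction = 1 ∧ ∀ v ∈ ℓ.direction, v.re = 0

/-- `(l, m)` are homogeneous minimal coordinates of the line `ℓ`: `l` is a direction vector of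
`ℓ` and `m` is the product of the conjugate of `l` with the pedal point `F` of `ℓ` with respect
to the origin. -/
def HasMinimalCoords (ℓ : AffineSubspace ℝ E4) (l m : E4) : Prop :=
  l ≠ 0 ∧ ℓ.direction = Submodule.span ℝ {l} ∧
    ∃ F : E4, F ∈ ℓ ∧ inner ℝ l F = 0 ∧ m = star l * F

/-- The rulings of the ruled surface determined by the lines `ℓ₁` and `ℓ₂`: the lines whose
homogeneous minimal coordinates lie on the straight line of projective space that joins the
coordinates of `ℓ₁` with those of `ℓ₂`. -/
def rulings (ℓ₁ ℓ₂ : AffineSubspace ℝ E4) : Set (AffineSubspace ℝ E4) :=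
  {ℓ | ∃ l₁ m₁ l₂ m₂ : E4, HasMinimalCoords ℓ₁ l₁ m₁ ∧ HasMinimalCoords ℓ₂ l₂ m₂ ∧
    ∃ a b : ℝ, HasMinimalCoords ℓ (a • l₁ + b • l₂) (a • m₁ + b • m₂)}

/-- The hyperplane `x₀ = 0`. -/
noncomputable def hyperplaneX0 : AffineSubspace ℝ E4 :=
  ((Submodule.span ℝ {(1 : E4)})ᗮ).toAffineSubspace

instance : Nonempty hyperplaneX0 :=
  ⟨⟨0, (Submodule.mem_toAffineSubspace).2 (Submodule.zero_mem _)⟩⟩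

/-- The line-symmetric motion whose basic surface has the set `R` of rulings: all
isometries obtained by first reflecting in the hyperplane `x₀ = 0` and then reflecting in a
ruling (the half-turn that fixes the ruling pointwise and is `-1` orthogonally to it). -/
def lineSymmetricMotion (R : Set (AffineSubspace ℝ E4)) : Set (E4 ≃ᵃⁱ[ℝ] E4) :=
  {g | ∃ ℓ ∈ R, ∃ _ : Nonempty ℓ,
    g = (EuclideanGeometry.reflection hyperplaneX0).trans (EuclideanGeometry.reflection ℓ)}

/-- Displacements: orientation-preserving isometries. -/
def IsDisplacement (g : E4 ≃ᵃⁱ[ℝ] E4) : Prop :=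
  LinearMap.det (g.linearIsometryEquiv.toLinearEquiv : E4 →ₗ[ℝ] E4) = 1

/-- One-parameter motions, regarded as the set of the displacements that they run through:
the image of a non-constant continuous curve in the group of displacements. -/
def IsMotion (S : Set (E4 ≃ᵃⁱ[ℝ] E4)) : Prop :=
  (∀ g ∈ S, IsDisplacement g) ∧ S.Nontrivial ∧
    ∃ G : ℝ → (E4 ≃ᵃⁱ[ℝ] E4), (∀ x, Continuous fun t => G t x) ∧ Set.range G = S

/-- The trajectory of the point `x` under the motion `S`. -/
def trajectory (S : Set (E4 ≃ᵃⁱ[ℝ] E4)) (x : E4) : Set E4 :=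
  (fun g : E4 ≃ᵃⁱ[ℝ] E4 => g x) '' S

/-- Circles, including single points as circles of radius `0` (the trajectories of the fixed
points of a rotation). -/
def IsCircle (C : Set E4) : Prop :=
  ∃ (P : AffineSubspace ℝ E4) (c : E4) (r : ℝ),
    Module.finrank ℝ P.direction = 2 ∧ c ∈ P ∧ 0 ≤ r ∧ C = (P : Set E4) ∩ Metric.sphere c r

/-- Circular Darboux 2-motions: all points have circular trajectories. -/
def IsCircularDarboux2Motion (S : Set (E4 ≃ᵃⁱ[ℝ] E4)) : Prop :=
  IsMotion S ∧ ∀ x, IsCircle (trajectory S x)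

/-- Spherical motions: some point stays fixed. -/
def IsSpherical (S : Set (E4 ≃ᵃⁱ[ℝ] E4)) : Prop :=
  ∃ x y : E4, ∀ g ∈ S, g x = y

/-- Pure translations: any two positions differ by a translation only. -/
def IsPureTranslation (S : Set (E4 ≃ᵃⁱ[ℝ] E4)) : Prop :=
  ∀ g ∈ S, ∀ h ∈ S, g.linearIsometryEquiv = h.linearIsometryEquiv

/-- The motion `S`, described in other Cartesian frames of the fixed space (`φ`) and of the
moving space (`ψ`). -/
def inFrames (φ ψ : E4 ≃ᵃⁱ[ℝ] E4) (S : Set (E4 ≃ᵃⁱ[ℝ] E4)) : Set (E4 ≃ᵃⁱ[ℝ] E4) :=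
  (fun g => ψ.trans (g.trans φ)) '' S

/-! For a ruling with coordinates `(l, m)` the displacement is `x ↦ ‖l‖⁻² l (2m - x l)`. After a
change of basis of the pencil, `l = e (cos t + u sin t)` with `‖e‖ = 1` and an imaginary unit `u`,
and this expression becomes `e (center x + (cos 2t + u sin 2t) amplitude x)`: every point runs
through a circle. A zero of the amplitude would force `m - u m'` to commute with `u`, which makes
the two lines coplanar. So for skew lines no point is fixed, and since the amplitude is not constant
the motion is not a translation (`exists_isCircularForm`).

For the converse, the motion is normalised to start at the identity; only planarity, sphericity and
continuity of the trajectories are used. Perturbing points inside their trajectory planes shows that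
all linear parts fix one common plane pointwise (`IsCircularMotion.exists_fixed_plane`). In complex
coordinates the motion is then `(z, w) ↦ (p z + b, w + d)` with `‖p‖ = 1`. Planarity makes `b` and
`d` real linear in `p - 1`, and the sphere condition reduces this to `b = α (p - 1)` and `d = γ (p -
1)` or its variant with the conjugate of `p - 1` (`IsSplit.exists_normal_form`). Up to isometries
this is contained in an explicit line-symmetric motion.

If the trajectories are full circles, containment becomes equality: one nondegenerate circle
contained in another equals it, and a displacement of a line-symmetric motion is determined by the
image of one point. -/

/-! ### Quaternion identities and minimal line coordinates -/

theorem quaternion_mul_star_mul (a x : E4) :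
    a * star x * a = (2 * inner ℝ a x) • a - ‖a‖ ^ 2 • x := by
  rw [sq, ← Quaternion.normSq_eq_norm_mul_self, Quaternion.inner_def, Quaternion.normSq_def']
  ext <;> simp <;> ring

theorem quaternion_re_one : (1 : E4).re = 1 := rfl

theorem quaternion_imI_one : (1 : E4).imI = 0 := rfl

theorem quaternion_imJ_one : (1 : E4).imJ = 0 := rfl

theorem quaternion_imK_one : (1 : E4).imK = 0 := rfl

/-- The centraliser of an imaginary unit is the complex plane it spans with `1`: evaluate `u * star
μ * u` once by `quaternion_mul_star_mul` and once by commuting. -/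
theorem mem_complex_of_commute {u μ : E4} (hu : u * u = -1) (hn : ‖u‖ = 1)
    (h : u * μ = μ * u) : μ = μ.re • (1 : E4) + (inner ℝ u μ : ℝ) • u := by
  have h1 := quaternion_mul_star_mul u μ
  have h2 : star μ = (2 * μ.re) • (1 : E4) - μ := by
    ext <;> simp [quaternion_re_one, quaternion_imI_one, quaternion_imJ_one, quaternion_imK_one]; ring
  rw [hn, h2, mul_sub, sub_mul, h, mul_assoc μ, hu, mul_smul_comm, mul_one, smul_mul_assoc, hu] at h1
  have h3 : (2 : ℝ) • μ = (2 : ℝ) • (μ.re • (1 : E4) + (inner ℝ u μ : ℝ) • u) := by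
    have h4 : μ = (2 * μ.re) • (1 : E4) + (2 * inner ℝ u μ) • u - μ := by
      simp only [one_pow, one_smul, smul_neg, mul_neg, mul_one, sub_neg_eq_add] at h1
      rw [add_sub_assoc]; exact neg_add_eq_iff_eq_add.1 h1
    rw [two_smul]
    nth_rewrite 2 [h4]
    module
  exact smul_right_injective E4 (two_ne_zero (α := ℝ)) h3

namespace HasMinimalCoords

variable {ℓ ℓ' : AffineSubspace ℝ E4} {l m l' m' : E4}

theorem re_moment (h : HasMinimalCoords ℓ l m) : m.re = 0 := by
  obtain ⟨-, -, F, -, hF, rfl⟩ := h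
  rw [Quaternion.inner_def] at hF
  simp at hF ⊢
  linarith

theorem pedal_mem (h : HasMinimalCoords ℓ l m) : (‖l‖ ^ 2)⁻¹ • (l * m) ∈ ℓ := by
  obtain ⟨hl, -, F, hF, -, rfl⟩ := h
  rw [← mul_assoc, Quaternion.self_mul_star, Quaternion.normSq_eq_norm_mul_self,
    Quaternion.coe_mul_eq_smul, ← sq, smul_smul, inv_mul_cancel₀ (by simpa using hl), one_smul]
  exact hF

theorem inner_pedal (h : HasMinimalCoords ℓ l m) :
    inner ℝ l ((‖l‖ ^ 2)⁻¹ • (l * m)) = 0 := by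
  have := h.re_moment
  rw [inner_smul_right, Quaternion.inner_def, star_mul]
  simp [this]
  ring_nf
  simp

theorem smul (h : HasMinimalCoords ℓ l m) {c : ℝ} (hc : c ≠ 0) :
    HasMinimalCoords ℓ (c • l) (c • m) := by
  obtain ⟨hl, hd, F, hF, h0, rfl⟩ := h
  refine ⟨smul_ne_zero hc hl, ?_, F, hF, by rw [inner_smul_left, h0, mul_zero], ?_⟩
  · rw [hd, Submodule.span_singleton_smul_eq (IsUnit.mk0 c hc)]
  · rw [Quaternion.star_smul, smul_mul_assoc]

theorem exists_eq_smul (h : HasMinimalCoords ℓ l m) (h' : HasMinimalCoords ℓ l' m') :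
    ∃ c : ℝ, c ≠ 0 ∧ l' = c • l ∧ m' = c • m := by
  obtain ⟨hl, hd, F, hF, h0, rfl⟩ := h
  obtain ⟨hl', hd', F', hF', h0', rfl⟩ := h'
  have h1 : l' ∈ Submodule.span ℝ {l} := by
    rw [← hd, hd']; exact Submodule.mem_span_singleton_self _
  obtain ⟨c, rfl⟩ := Submodule.mem_span_singleton.1 h1
  have hc : c ≠ 0 := by rintro rfl; simp at hl'
  have h2 : F' - F ∈ Submodule.span ℝ {l} := by
    rw [← hd]; exact AffineSubspace.vsub_mem_direction hF' hF
  obtain ⟨d, hd2⟩ := Submodule.mem_span_singleton.1 h2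
  have h3 : inner ℝ l F' = 0 := by
    rw [inner_smul_left] at h0'
    simpa [hc] using h0'
  have h4 : d * (‖l‖ ^ 2) = 0 := by
    rw [← real_inner_self_eq_norm_sq, ← inner_smul_right, hd2, inner_sub_right, h0, h3, sub_zero]
  have h5 : d = 0 := by simpa [hl] using h4
  have h6 : F' = F := by
    rw [h5, zero_smul] at hd2
    exact (sub_eq_zero.1 hd2.symm)
  refine ⟨c, hc, rfl, ?_⟩
  rw [h6, Quaternion.star_smul, smul_mul_assoc]

end HasMinimalCoords

theorem hasMinimalCoords_mk' {l m : E4} (hl : l ≠ 0) (hm : m.re = 0) :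
    HasMinimalCoords (AffineSubspace.mk' ((‖l‖ ^ 2)⁻¹ • (l * m)) (Submodule.span ℝ {l})) l m := by
  refine ⟨hl, by simp, _, AffineSubspace.self_mem_mk' _ _, ?_, ?_⟩
  · rw [inner_smul_right, Quaternion.inner_def, star_mul]
    simp [hm]
    ring_nf
    simp
  · rw [mul_smul_comm, ← mul_assoc, Quaternion.star_mul_self, Quaternion.normSq_eq_norm_mul_self,
      Quaternion.coe_mul_eq_smul, ← sq, smul_smul, inv_mul_cancel₀ (by simpa using hl), one_smul]

theorem IsLineOrthX0.exists_minimalCoords {ℓ : AffineSubspace ℝ E4} (h : IsLineOrthX0 ℓ) :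
    ∃ l m : E4, HasMinimalCoords ℓ l m ∧ l.re = 0 := by
  obtain ⟨⟨p, hp⟩, h1, h2⟩ := h
  obtain ⟨⟨l, hl⟩, hl0, hs⟩ := finrank_eq_one_iff'.1 h1
  have hl0' : l ≠ 0 := fun h => hl0 (Subtype.ext h)
  have hd : ℓ.direction = Submodule.span ℝ {l} := by
    apply le_antisymm
    · intro w hw
      obtain ⟨c, hc⟩ := hs ⟨w, hw⟩
      exact Submodule.mem_span_singleton.2 ⟨c, congrArg Subtype.val hc⟩
    · rw [Submodule.span_singleton_le_iff_mem]; exact hl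
  refine ⟨l, _, ⟨hl0', hd, p - (inner ℝ l p / ‖l‖ ^ 2) • l, ?_, ?_, rfl⟩, h2 l hl⟩
  · have := AffineSubspace.vadd_mem_of_mem_direction
      (ℓ.direction.smul_mem (-(inner ℝ l p / ‖l‖ ^ 2)) hl) hp
    rwa [vadd_eq_add, neg_smul, neg_add_eq_sub] at this
  · rw [inner_sub_right, inner_smul_right, real_inner_self_eq_norm_sq,
      div_mul_cancel₀ _ (by simpa using hl0'), sub_self]

/-- Rescaling the homogeneous coordinates of the two lines only rescales `a` and `b`, so one fixed
choice of coordinates suffices. -/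
theorem mem_rulings_iff {ℓ₁ ℓ₂ ℓ : AffineSubspace ℝ E4} {l₁ m₁ l₂ m₂ : E4}
    (h₁ : HasMinimalCoords ℓ₁ l₁ m₁) (h₂ : HasMinimalCoords ℓ₂ l₂ m₂) :
    ℓ ∈ rulings ℓ₁ ℓ₂ ↔
      ∃ a b : ℝ, HasMinimalCoords ℓ (a • l₁ + b • l₂) (a • m₁ + b • m₂) := by
  constructor
  · rintro ⟨l₁', m₁', l₂', m₂', h₁', h₂', a, b, h⟩
    obtain ⟨c, -, rfl, rfl⟩ := h₁.exists_eq_smul h₁'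
    obtain ⟨d, -, rfl, rfl⟩ := h₂.exists_eq_smul h₂'
    exact ⟨a * c, b * d, by simpa only [smul_smul] using h⟩
  · rintro ⟨a, b, h⟩
    exact ⟨l₁, m₁, l₂, m₂, h₁, h₂, a, b, h⟩

/-! ### Quaternion formulas for the displacements of a line-symmetric motion -/

theorem HasMinimalCoords.reflection_apply {ℓ : AffineSubspace ℝ E4} {l m : E4}
    (h : HasMinimalCoords ℓ l m) [Nonempty ℓ] (x : E4) :
    EuclideanGeometry.reflection ℓ x = (‖l‖ ^ 2)⁻¹ • (l * star x * l + (2 : ℝ) • (l * m)) := by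
  have key : ∀ (K : Submodule ℝ E4) (v : E4), K = Submodule.span ℝ {l} →
      K.reflection v = (2 : ℝ) • ((inner ℝ l v : ℝ) / ‖l‖ ^ 2) • l - v := by
    rintro K v rfl
    rw [Submodule.reflection_singleton_apply]
    simp [two_smul]
  have hl : ‖l‖ ^ 2 ≠ 0 := by simpa using h.1
  rw [EuclideanGeometry.reflection_apply_of_mem ℓ x h.pedal_mem, key _ _ h.2.1, vsub_eq_sub,
    inner_sub_right, h.inner_pedal, vadd_eq_add, quaternion_mul_star_mul, smul_add, smul_sub,
    smul_smul _ _ x, inv_mul_cancel₀ hl, div_eq_inv_mul]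
  module

theorem reflection_hyperplaneX0_apply (x : E4) :
    EuclideanGeometry.reflection hyperplaneX0 x = -star x := by
  have h0 : (0 : E4) ∈ hyperplaneX0 := (Submodule.mem_toAffineSubspace).2 (Submodule.zero_mem _)
  have key : ∀ (K : Submodule ℝ E4) (v : E4), K = (Submodule.span ℝ {(1 : E4)})ᗮ →
      K.reflection v = -((2 : ℝ) • (inner ℝ (1 : E4) v : ℝ) • (1 : E4) - v) := by
    rintro K v rfl
    rw [Submodule.reflection_orthogonal_apply, Submodule.reflection_singleton_apply]
    simp [two_smul]
  rw [EuclideanGeometry.reflection_apply_of_mem _ x h0, key _ _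
    (by rw [hyperplaneX0, Submodule.toAffineSubspace_direction]), vsub_eq_sub, sub_zero, vadd_eq_add,
    add_zero, Quaternion.inner_def]
  ext <;> simp [quaternion_re_one, quaternion_imI_one, quaternion_imJ_one, quaternion_imK_one]
  ring

/-- The hyperplane reflection is `x ↦ -star x`; it cancels the conjugation in the half-turn formula.
-/
theorem HasMinimalCoords.halfTurn_apply {ℓ : AffineSubspace ℝ E4} {l m : E4}
    (h : HasMinimalCoords ℓ l m) [Nonempty ℓ] (x : E4) :
    ((EuclideanGeometry.reflection hyperplaneX0).trans (EuclideanGeometry.reflection ℓ)) x =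
      (‖l‖ ^ 2)⁻¹ • (l * ((2 : ℝ) • m - x * l)) := by
  rw [AffineIsometryEquiv.coe_trans, Function.comp_apply, h.reflection_apply,
    reflection_hyperplaneX0_apply]
  congr 1
  rw [star_neg, star_star, mul_sub, mul_smul_comm, ← mul_assoc]
  simp only [mul_neg, neg_mul]
  abel

theorem isDisplacement_halfTurn {ℓ : AffineSubspace ℝ E4} [Nonempty ℓ]
    (h : Module.finrank ℝ ℓ.direction = 1) :
    IsDisplacement
      ((EuclideanGeometry.reflection hyperplaneX0).trans (EuclideanGeometry.reflection ℓ)) := by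
  have h1 : Module.finrank ℝ ℓ.directionᗮ = 3 := by
    have := ℓ.direction.finrank_add_finrank_orthogonal
    rw [Quaternion.finrank_eq_four] at this
    omega
  have h2 : Module.finrank ℝ hyperplaneX0.directionᗮ = 1 := by
    rw [hyperplaneX0, Submodule.toAffineSubspace_direction, Submodule.orthogonal_orthogonal]
    exact finrank_span_singleton one_ne_zero
  have h3 : (((EuclideanGeometry.reflection hyperplaneX0).trans
      (EuclideanGeometry.reflection ℓ)).linearIsometryEquiv.toLinearEquiv : E4 →ₗ[ℝ] E4) =
      ℓ.direction.reflection.toLinearMap ∘ₗ hyperplaneX0.direction.reflection.toLinearMap := by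
    ext1 x
    rfl
  -- The determinant is `(-1) ^ 3 * (-1) ^ 1`.
  rw [IsDisplacement, h3, LinearMap.det_comp, Submodule.det_reflection, Submodule.det_reflection,
    h1, h2]
  norm_num

theorem finrank_span_pair_le_two (x y : E4) :
    Module.finrank ℝ (Submodule.span ℝ {x, y}) ≤ 2 := by
  rw [← Matrix.range_cons_cons_empty x y ![]]
  exact (finrank_range_le_card _).trans (by simp)

theorem coplanar_union_of_pedal_sub_mem {ℓ₁ ℓ₂ : AffineSubspace ℝ E4} {l₁ m₁ l₂ m₂ : E4}
    (h₁ : HasMinimalCoords ℓ₁ l₁ m₁) (h₂ : HasMinimalCoords ℓ₂ l₂ m₂) {W : Submodule ℝ E4}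
    (hW : Module.finrank ℝ W ≤ 2) (hl₁ : l₁ ∈ W) (hl₂ : l₂ ∈ W)
    (hF : (‖l₁‖ ^ 2)⁻¹ • (l₁ * m₁) - (‖l₂‖ ^ 2)⁻¹ • (l₂ * m₂) ∈ W) :
    Coplanar ℝ ((ℓ₁ : Set E4) ∪ (ℓ₂ : Set E4)) := by
  rw [coplanar_iff_finrank_le_two]
  refine le_trans (Submodule.finrank_mono ?_) hW
  have key : ∀ x ∈ (ℓ₁ : Set E4) ∪ (ℓ₂ : Set E4), x - (‖l₁‖ ^ 2)⁻¹ • (l₁ * m₁) ∈ W := by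
    rintro x (hx | hx)
    · have h : x - (‖l₁‖ ^ 2)⁻¹ • (l₁ * m₁) ∈ ℓ₁.direction :=
        AffineSubspace.vsub_mem_direction hx h₁.pedal_mem
      rw [h₁.2.1] at h
      exact (Submodule.span_singleton_le_iff_mem _ _).2 hl₁ h
    · have h : x - (‖l₂‖ ^ 2)⁻¹ • (l₂ * m₂) ∈ ℓ₂.direction :=
        AffineSubspace.vsub_mem_direction hx h₂.pedal_mem
      rw [h₂.2.1] at h
      have h' := (Submodule.span_singleton_le_iff_mem _ _).2 hl₂ h
      have := W.sub_mem h' hF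
      rwa [sub_sub_sub_cancel_right] at this
  rw [vectorSpan_def, Submodule.span_le]
  rintro _ ⟨x, hx, y, hy, rfl⟩
  have := W.sub_mem (key x hx) (key y hy)
  rwa [sub_sub_sub_cancel_right] at this

/-! ### Motions in circular form -/

/-- The point `cos t + u sin t` of the unit circle of the complex plane spanned by `1` and `u`. -/
noncomputable def circlePoint (u : E4) (t : ℝ) : E4 := Real.cos t • (1 : E4) + Real.sin t • u

theorem circlePoint_zero (u : E4) : circlePoint u 0 = 1 := by simp [circlePoint]

theorem circlePoint_pi (u : E4) : circlePoint u Real.pi = -1 := by simp [circlePoint]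

theorem norm_sq_complex {u : E4} (hu : u.re = 0) (hn : ‖u‖ = 1) (a b : ℝ) :
    ‖a • (1 : E4) + b • u‖ ^ 2 = a ^ 2 + b ^ 2 := by
  have h1 : ‖u‖ * ‖u‖ = 1 := by rw [hn, mul_one]
  rw [← Quaternion.normSq_eq_norm_mul_self, Quaternion.normSq_def', hu] at h1
  rw [sq, ← Quaternion.normSq_eq_norm_mul_self, Quaternion.normSq_def']
  simp [quaternion_re_one, quaternion_imI_one, quaternion_imJ_one, quaternion_imK_one, hu]
  linear_combination b ^ 2 * h1

theorem continuous_circlePoint (u : E4) : Continuous (circlePoint u) := by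
  unfold circlePoint
  fun_prop

theorem exists_cos_sin {a b : ℝ} (h : a ^ 2 + b ^ 2 = 1) :
    ∃ t : ℝ, a = Real.cos t ∧ b = Real.sin t := by
  have hz : ‖(⟨a, b⟩ : ℂ)‖ = 1 := by
    rw [Complex.norm_def, Complex.normSq_mk, ← sq, ← sq, h, Real.sqrt_one]
  refine ⟨Complex.arg ⟨a, b⟩, ?_, ?_⟩
  · have := Complex.norm_mul_cos_arg ⟨a, b⟩
    rw [hz, one_mul] at this
    exact this.symm
  · have := Complex.norm_mul_sin_arg ⟨a, b⟩
    rw [hz, one_mul] at this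
    exact this.symm

/-- The motion `M` consists of the maps `x ↦ l (q x + (cos t + u sin t) p x)`, where `u` is an
imaginary unit and `p` a nonconstant map without zeros. -/
structure IsCircularForm (M : Set (E4 ≃ᵃⁱ[ℝ] E4)) (l u : E4) (p q : E4 → E4) : Prop where
  norm_l : ‖l‖ = 1
  re_u : u.re = 0
  norm_u : ‖u‖ = 1
  ne_zero : ∀ x, p x ≠ 0
  ne_const : ∃ x, p x ≠ p 0
  exists_curve : ∃ G : ℝ → (E4 ≃ᵃⁱ[ℝ] E4),
    (∀ t x, G t x = l * (q x + circlePoint u t * p x)) ∧ Set.range G = M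

namespace IsCircularForm

variable {M : Set (E4 ≃ᵃⁱ[ℝ] E4)} {l u : E4} {p q : E4 → E4}

theorem l_ne_zero (h : IsCircularForm M l u p q) : l ≠ 0 := by
  rintro rfl; simpa using h.norm_l

theorem mem_iff (h : IsCircularForm M l u p q) (g : E4 ≃ᵃⁱ[ℝ] E4) :
    g ∈ M ↔ ∃ t, ∀ x, g x = l * (q x + circlePoint u t * p x) := by
  obtain ⟨G, hG, rfl⟩ := h.exists_curve
  constructor
  · rintro ⟨t, rfl⟩
    exact ⟨t, hG t⟩
  · rintro ⟨t, ht⟩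
    exact ⟨t, by ext1 x; rw [hG, ht]⟩

/-- As `p x ≠ 0`, the image of `x` determines the factor `circlePoint u t`, hence the whole
displacement. -/
theorem eq_of_apply_eq (h : IsCircularForm M l u p q) {g g' : E4 ≃ᵃⁱ[ℝ] E4} (hg : g ∈ M)
    (hg' : g' ∈ M) {x : E4} (hx : g x = g' x) : g = g' := by
  obtain ⟨t, ht⟩ := (h.mem_iff g).1 hg
  obtain ⟨t', ht'⟩ := (h.mem_iff g').1 hg'
  rw [ht, ht'] at hx
  have h1 := mul_right_cancel₀ (h.ne_zero x) (add_left_cancel (mul_left_cancel₀ h.l_ne_zero hx))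
  ext1 y
  rw [ht, ht', h1]

theorem isCircle_trajectory (h : IsCircularForm M l u p q) (x : E4) :
    IsCircle (trajectory M x) := by
  obtain ⟨G, hG, hM⟩ := h.exists_curve
  have hcomb : ∀ a b : ℝ, a • (l * p x) + b • (l * (u * p x)) =
      l * ((a • (1 : E4) + b • u) * p x) := by
    intro a b
    rw [add_mul, mul_add, smul_mul_assoc, smul_mul_assoc, mul_smul_comm, mul_smul_comm, one_mul]
  have hnorm : ∀ a b : ℝ, ‖a • (l * p x) + b • (l * (u * p x))‖ ^ 2 =
      (a ^ 2 + b ^ 2) * ‖p x‖ ^ 2 := by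
    intro a b
    rw [hcomb, norm_mul, norm_mul, h.norm_l, one_mul, mul_pow, norm_sq_complex h.re_u h.norm_u]
  have hp : 0 < ‖p x‖ ^ 2 := by have := h.ne_zero x; positivity
  refine ⟨AffineSubspace.mk' (l * q x) (Submodule.span ℝ {l * p x, l * (u * p x)}), l * q x, ‖p x‖,
    ?_, AffineSubspace.self_mem_mk' _ _, norm_nonneg _, ?_⟩
  · have hli : LinearIndependent ℝ ![l * p x, l * (u * p x)] := by
      rw [LinearIndependent.pair_iff]
      intro a b hab
      have h1 := hnorm a b
      rw [hab, norm_zero] at h1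
      have h2 : a ^ 2 + b ^ 2 = 0 := by
        rcases mul_eq_zero.1 (h1.symm.trans (by norm_num)) with h2 | h2
        · exact h2
        · exact absurd h2 hp.ne'
      constructor <;> nlinarith [sq_nonneg a, sq_nonneg b]
    rw [AffineSubspace.direction_mk', ← Matrix.range_cons_cons_empty, finrank_span_eq_card hli]
    simp
  · ext y
    constructor
    · rintro ⟨g, hg, rfl⟩
      obtain ⟨t, ht⟩ := (h.mem_iff g).1 hg
      have h1 : g x - l * q x = Real.cos t • (l * p x) + Real.sin t • (l * (u * p x)) := by
        rw [hcomb, ht, mul_add, add_sub_cancel_left, circlePoint]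
      refine ⟨?_, ?_⟩
      · change g x - l * q x ∈ Submodule.span ℝ {l * p x, l * (u * p x)}
        rw [h1]
        exact Submodule.mem_span_pair.2 ⟨_, _, rfl⟩
      · rw [mem_sphere_iff_norm, ← sq_eq_sq₀ (norm_nonneg _) (norm_nonneg _), h1, hnorm,
          Real.cos_sq_add_sin_sq, one_mul]
    · rintro ⟨h1, h2⟩
      obtain ⟨a, b, hab⟩ := Submodule.mem_span_pair.1
        (show y - l * q x ∈ Submodule.span ℝ {l * p x, l * (u * p x)} from h1)
      rw [mem_sphere_iff_norm, ← hab, ← sq_eq_sq₀ (norm_nonneg _) (norm_nonneg _), hnorm] at h2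
      obtain ⟨t, rfl, rfl⟩ := exists_cos_sin
        (mul_right_cancel₀ hp.ne' (h2.trans (one_mul _).symm))
      refine ⟨G t, hM ▸ ⟨t, rfl⟩, ?_⟩
      change G t x = y
      rw [hG, mul_add, circlePoint, ← hcomb, hab, add_sub_cancel]

/-- Opposite positions on the circles differ by a diameter. This detects fixed points through zeros
of `p`, and pure translations through constancy of `p`. -/
theorem zero_mem_pi_mem (h : IsCircularForm M l u p q) :
    ∃ g ∈ M, ∃ g' ∈ M, ∀ x, g x - g' x = (2 : ℝ) • (l * p x) := by
  obtain ⟨G, hG, hM⟩ := h.exists_curve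
  refine ⟨G 0, hM ▸ ⟨0, rfl⟩, G Real.pi, hM ▸ ⟨_, rfl⟩, fun x => ?_⟩
  rw [hG, hG, circlePoint_zero, circlePoint_pi, one_mul, neg_one_mul, ← mul_sub, two_smul,
    ← mul_add]
  congr 1
  abel

theorem isCircularDarboux2Motion (h : IsCircularForm M l u p q)
    (hM : ∀ g ∈ M, IsDisplacement g) : IsCircularDarboux2Motion M := by
  refine ⟨⟨hM, ?_, ?_⟩, h.isCircle_trajectory⟩
  · obtain ⟨g, hg, g', hg', hgg⟩ := h.zero_mem_pi_mem
    refine ⟨g, hg, g', hg', ?_⟩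
    rintro rfl
    have := hgg 0
    rw [sub_self] at this
    exact smul_ne_zero two_ne_zero (mul_ne_zero h.l_ne_zero (h.ne_zero 0)) this.symm
  · obtain ⟨G, hG, hGM⟩ := h.exists_curve
    refine ⟨G, fun x => ?_, hGM⟩
    simp_rw [hG]
    have := continuous_circlePoint u
    fun_prop

theorem not_isSpherical (h : IsCircularForm M l u p q) : ¬ IsSpherical M := by
  rintro ⟨x, y, hxy⟩
  obtain ⟨g, hg, g', hg', hgg⟩ := h.zero_mem_pi_mem
  have := hgg x
  rw [hxy g hg, hxy g' hg', sub_self] at this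
  exact smul_ne_zero two_ne_zero (mul_ne_zero h.l_ne_zero (h.ne_zero x)) this.symm

theorem not_isPureTranslation (h : IsCircularForm M l u p q) : ¬ IsPureTranslation M := by
  intro htr
  obtain ⟨g, hg, g', hg', hgg⟩ := h.zero_mem_pi_mem
  obtain ⟨x, hx⟩ := h.ne_const
  have h1 : ∀ f : E4 ≃ᵃⁱ[ℝ] E4, f.linearIsometryEquiv x = f x - f 0 := by
    intro f
    have := f.map_vsub x 0
    simpa using this
  have h2 : g x - g 0 = g' x - g' 0 := by rw [← h1, ← h1, htr g hg g' hg']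
  have h3 : (2 : ℝ) • (l * p x) = (2 : ℝ) • (l * p 0) := by
    rw [← hgg, ← hgg, sub_eq_sub_iff_sub_eq_sub, h2]
  exact hx (mul_left_cancel₀ h.l_ne_zero (smul_right_injective E4 (two_ne_zero (α := ℝ)) h3))

end IsCircularForm

/-! ### Skew lines give circular forms -/

/-- With `exp (u t) = cos t + u sin t`, the pencil `cos t n₁ + sin t n₂` is half of `exp (u t) (n₁ -
u n₂) + exp (-u t) (n₁ + u n₂)`. Multiplication by `exp (u t)` doubles one frequency and cancels the
other. -/
theorem mul_pencil_eq {u : E4} (hu : u * u = -1) (n₁ n₂ : E4) (t : ℝ) :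
    circlePoint u t * (Real.cos t • n₁ + Real.sin t • n₂) =
      (2⁻¹ : ℝ) • (n₁ + u * n₂) + circlePoint u (2 * t) * ((2⁻¹ : ℝ) • (n₁ - u * n₂)) := by
  have huu : ∀ x : E4, u * (u * x) = -x := fun x => by rw [← mul_assoc, hu, neg_one_mul]
  have h1 : Real.cos (2 * t) = Real.cos t ^ 2 - Real.sin t ^ 2 := by
    rw [Real.cos_two_mul, Real.sin_sq]; ring
  have h2 := Real.cos_sq_add_sin_sq t
  rw [circlePoint, circlePoint, h1, Real.sin_two_mul]
  generalize Real.cos t = a at *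
  generalize Real.sin t = b at *
  have h3 : (2⁻¹ : ℝ) • (n₁ + u * n₂) = (a ^ 2 + b ^ 2) • (2⁻¹ : ℝ) • (n₁ + u * n₂) := by
    rw [h2, one_smul]
  rw [h3]
  simp only [add_mul, mul_add, mul_sub, smul_mul_assoc, mul_smul_comm, one_mul, huu]
  module

theorem commute_sub_conj {u : E4} (hu : u * u = -1) (y : E4) :
    u * (y - u * y * u) = (y - u * y * u) * u := by
  have h1 : u * (u * y * u) = -(y * u) := by
    rw [← mul_assoc, ← mul_assoc, hu, neg_one_mul, neg_mul]
  have h2 : u * y * u * u = -(u * y) := by rw [mul_assoc, hu, mul_neg_one]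
  rw [mul_sub, sub_mul, h1, h2]
  abel

/-- The amplitude, as a function of the moving point, of the line-symmetric motion whose rulings
have the coordinates `(a e + b e u, a m + b m')`. -/
noncomputable def amplitude (e u m m' x : E4) : E4 :=
  (2⁻¹ : ℝ) • (((2 : ℝ) • m - x * e) - u * ((2 : ℝ) • m' - x * (e * u)))

/-- The center, as a function of the moving point, of the line-symmetric motion whose rulings
have the coordinates `(a e + b e u, a m + b m')`. -/
noncomputable def center (e u m m' x : E4) : E4 :=
  (2⁻¹ : ℝ) • (((2 : ℝ) • m - x * e) + u * ((2 : ℝ) • m' - x * (e * u)))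

/-- At a zero, `2 (m - u m')` equals `y - u y u` with `y = x e`, and everything of that form
commutes with `u`. -/
theorem commute_of_amplitude_eq_zero {e u m m' x : E4} (hu : u * u = -1)
    (h : amplitude e u m m' x = 0) : u * (m - u * m') = (m - u * m') * u := by
  have h1 := (smul_eq_zero.1 h).resolve_left (by norm_num)
  have h2 : (2 : ℝ) • (m - u * m') = x * e - u * (x * e) * u := by
    rw [← sub_eq_zero, ← h1, smul_sub, mul_sub, mul_smul_comm, mul_assoc u (x * e), mul_assoc x]
    abel
  have h3 := commute_sub_conj hu (x * e)
  rw [← h2, mul_smul_comm, smul_mul_assoc] at h3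
  exact smul_right_injective E4 (two_ne_zero (α := ℝ)) h3

theorem amplitude_sub_amplitude_zero {e u m m' : E4} (hu : u * u = -1) (he : star e * e = 1) :
    amplitude e u m m' (star e) - amplitude e u m m' 0 = -1 := by
  have h1 : star e * (e * u) = u := by rw [← mul_assoc, he, one_mul]
  rw [amplitude, amplitude, he, h1, ← smul_sub, zero_mul, zero_mul]
  have : (2 : ℝ) • m - 1 - u * ((2 : ℝ) • m' - u) - ((2 : ℝ) • m - 0 - u * ((2 : ℝ) • m' - 0)) =
      (2 : ℝ) • (-1 : E4) := by
    rw [mul_sub, hu, sub_zero, sub_zero, two_smul ℝ (-1 : E4)]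
    abel
  rw [this, smul_smul]
  norm_num

theorem isCircularForm_of_rulings {R : Set (AffineSubspace ℝ E4)} {e u m m' : E4}
    (he : ‖e‖ = 1) (hu : u * u = -1) (hur : u.re = 0) (hun : ‖u‖ = 1) (hm : m.re = 0)
    (hm' : m'.re = 0) (hc : u * (m - u * m') ≠ (m - u * m') * u)
    (hR : ∀ ℓ, ℓ ∈ R ↔
      ∃ a b : ℝ, HasMinimalCoords ℓ (a • e + b • (e * u)) (a • m + b • m')) :
    IsCircularForm (lineSymmetricMotion R) e u (amplitude e u m m') (center e u m m') := by
  have hnorm : ∀ a b : ℝ, ‖a • e + b • (e * u)‖ ^ 2 = a ^ 2 + b ^ 2 := by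
    intro a b
    have : a • e + b • (e * u) = e * (a • (1 : E4) + b • u) := by
      rw [mul_add, mul_smul_comm, mul_smul_comm, mul_one]
    rw [this, norm_mul, he, one_mul, norm_sq_complex hur hun]
  have hval : ∀ t x, (Real.cos t • e + Real.sin t • (e * u)) *
      ((2 : ℝ) • (Real.cos t • m + Real.sin t • m') -
        x * (Real.cos t • e + Real.sin t • (e * u))) =
      e * (center e u m m' x + circlePoint u (2 * t) * amplitude e u m m' x) := by
    intro t x
    rw [center, amplitude, ← mul_pencil_eq hu, circlePoint, ← mul_assoc]
    congr 1
    · rw [mul_add, mul_smul_comm, mul_smul_comm, mul_one]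
    · rw [mul_add, mul_smul_comm, mul_smul_comm]
      module
  have hline : ∀ t, ∃ ℓ ∈ R, HasMinimalCoords ℓ (Real.cos t • e + Real.sin t • (e * u))
      (Real.cos t • m + Real.sin t • m') := by
    intro t
    have h0 : Real.cos t • e + Real.sin t • (e * u) ≠ 0 := by
      intro h0
      have := hnorm (Real.cos t) (Real.sin t)
      rw [h0, Real.cos_sq_add_sin_sq] at this
      simp at this
    have h1 := hasMinimalCoords_mk' h0
      (show (Real.cos t • m + Real.sin t • m').re = 0 by simp [hm, hm'])
    exact ⟨_, (hR _).2 ⟨_, _, h1⟩, h1⟩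
  have happly : ∀ (ℓ : AffineSubspace ℝ E4) (t : ℝ) [Nonempty ℓ],
      HasMinimalCoords ℓ (Real.cos t • e + Real.sin t • (e * u))
        (Real.cos t • m + Real.sin t • m') → ∀ x,
      ((EuclideanGeometry.reflection hyperplaneX0).trans (EuclideanGeometry.reflection ℓ)) x =
        e * (center e u m m' x + circlePoint u (2 * t) * amplitude e u m m' x) := by
    intro ℓ t _ h x
    rw [h.halfTurn_apply, hnorm, Real.cos_sq_add_sin_sq, inv_one, one_smul, hval]
  refine ⟨he, hur, hun, fun x hx => hc (commute_of_amplitude_eq_zero hu hx),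
    ⟨star e, fun h => ?_⟩, ?_⟩
  · have h1 := amplitude_sub_amplitude_zero (m := m) (m' := m') hu
      (show star e * e = 1 by
        rw [Quaternion.star_mul_self, Quaternion.normSq_eq_norm_mul_self, he]; simp)
    rw [h, sub_self] at h1
    exact neg_ne_zero.2 one_ne_zero h1.symm
  · choose ℓ hℓ hℓc using hline
    have hne : ∀ t, Nonempty (ℓ t) := fun t => ⟨⟨_, (hℓc t).pedal_mem⟩⟩
    -- The ruling at angle `t` acts with phase `2 t`, hence the half angle.
    refine ⟨fun t => (EuclideanGeometry.reflection hyperplaneX0).trans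
      (EuclideanGeometry.reflection (ℓ (t / 2))), fun t x => ?_, ?_⟩
    · rw [happly _ _ (hℓc _), mul_div_cancel₀ _ two_ne_zero]
    · ext g
      constructor
      · rintro ⟨t, rfl⟩
        exact ⟨_, hℓ _, inferInstance, rfl⟩
      · rintro ⟨ℓ', hℓ', hne', rfl⟩
        obtain ⟨a, b, hab⟩ := (hR ℓ').1 hℓ'
        have hpos : 0 < a ^ 2 + b ^ 2 := by
          rw [← hnorm]
          have := hab.1
          positivity
        set r := Real.sqrt (a ^ 2 + b ^ 2) with hr
        have hr0 : 0 < r := Real.sqrt_pos.2 hpos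
        have hr2 : r ^ 2 = a ^ 2 + b ^ 2 := Real.sq_sqrt hpos.le
        obtain ⟨t, ht1, ht2⟩ := exists_cos_sin (a := r⁻¹ * a) (b := r⁻¹ * b) (by
          field_simp
          exact hr2.symm)
        have h1 := hab.smul (inv_ne_zero hr0.ne')
        rw [smul_add, smul_add, smul_smul, smul_smul, smul_smul, smul_smul, ht1, ht2] at h1
        refine ⟨2 * t, ?_⟩
        ext1 x
        rw [happly _ _ h1, happly _ _ (hℓc _), mul_div_cancel_left₀ _ two_ne_zero]

theorem exists_isCircularForm {ℓ₁ ℓ₂ : AffineSubspace ℝ E4} (h₁ : IsLineOrthX0 ℓ₁)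
    (h₂ : IsLineOrthX0 ℓ₂) (h : ¬ Coplanar ℝ ((ℓ₁ : Set E4) ∪ (ℓ₂ : Set E4))) :
    ∃ l u p q, IsCircularForm (lineSymmetricMotion (rulings ℓ₁ ℓ₂)) l u p q := by
  obtain ⟨l₁, m₁, hc₁, hl₁⟩ := h₁.exists_minimalCoords
  obtain ⟨l₂, m₂, hc₂, hl₂⟩ := h₂.exists_minimalCoords
  have hm₁ := hc₁.re_moment
  have hm₂ := hc₂.re_moment
  obtain ⟨r, e, hr, he, rfl⟩ : ∃ (r : ℝ) (e : E4), r ≠ 0 ∧ ‖e‖ = 1 ∧ l₁ = r • e := by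
    have h0 := norm_ne_zero_iff.2 hc₁.1
    exact ⟨‖l₁‖, ‖l₁‖⁻¹ • l₁, h0, by rw [norm_smul, norm_inv, norm_norm, inv_mul_cancel₀ h0],
      by rw [smul_smul, mul_inv_cancel₀ h0, one_smul]⟩
  obtain ⟨m, rfl⟩ : ∃ m : E4, m₁ = r • m :=
    ⟨r⁻¹ • m₁, by rw [smul_smul, mul_inv_cancel₀ hr, one_smul]⟩
  have hmr : m.re = 0 := by simpa [hr] using hm₁
  have hpedal₁ : (‖r • e‖ ^ 2)⁻¹ • ((r • e) * (r • m)) = e * m := by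
    rw [norm_smul, he, mul_one, smul_mul_assoc, mul_smul_comm, smul_smul, smul_smul,
      Real.norm_eq_abs, sq_abs, mul_assoc, ← sq, inv_mul_cancel₀ (pow_ne_zero 2 hr), one_smul]
  obtain ⟨c, hf0⟩ : ∃ c : ℝ, inner ℝ e (l₂ - c • e) = 0 :=
    ⟨inner ℝ e l₂, by
      rw [inner_sub_right, inner_smul_right, real_inner_self_eq_norm_sq, he]; ring⟩
  -- Parallel lines lie in the plane directed by `e` and the difference of the pedal points.
  have hne : l₂ - c • e ≠ 0 := by
    intro h0
    refine h (coplanar_union_of_pedal_sub_mem hc₁ hc₂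
      (W := Submodule.span ℝ {e, e * m - (‖l₂‖ ^ 2)⁻¹ • (l₂ * m₂)})
      ?_ ?_ ?_ ?_)
    · exact finrank_span_pair_le_two _ _
    · exact Submodule.smul_mem _ _ (Submodule.subset_span (by simp))
    · rw [sub_eq_zero.1 h0]
      exact Submodule.smul_mem _ _ (Submodule.subset_span (by simp))
    · rw [hpedal₁]
      exact Submodule.subset_span (by simp)
  -- Gram–Schmidt: `e * u` is the normalised component of `l₂` orthogonal to `e`. That orthogonality
  -- says that `u` has real part zero.
  obtain ⟨d, u, hd, hun, hu⟩ : ∃ (d : ℝ) (u : E4), d ≠ 0 ∧ ‖u‖ = 1 ∧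
      l₂ = c • e + d • (e * u) := by
    have h0 := norm_ne_zero_iff.2 hne
    refine ⟨‖l₂ - c • e‖, ‖l₂ - c • e‖⁻¹ • (star e * (l₂ - c • e)), h0, ?_, ?_⟩
    · rw [norm_smul, norm_mul, Quaternion.norm_star, he, one_mul, norm_inv, norm_norm,
        inv_mul_cancel₀ h0]
    · rw [mul_smul_comm, smul_smul, mul_inv_cancel₀ h0, one_smul, ← mul_assoc,
        Quaternion.self_mul_star, Quaternion.normSq_eq_norm_mul_self, he]
      simp
  subst hu
  have hur : u.re = 0 := by
    rw [add_sub_cancel_left, inner_smul_right] at hf0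
    have h1 := (mul_eq_zero.1 hf0).resolve_left hd
    have h2 : ‖e‖ * ‖e‖ = 1 := by rw [he, one_mul]
    rw [← Quaternion.normSq_eq_norm_mul_self, Quaternion.normSq_def'] at h2
    rw [Quaternion.inner_def] at h1
    simp at h1
    linear_combination h1 - u.re * h2
  have huu : u * u = -1 := by
    have h1 : star u = -u := by
      rw [Quaternion.star_eq_neg]; exact hur
    have h2 := Quaternion.star_mul_self u
    rw [h1, Quaternion.normSq_eq_norm_mul_self, hun, neg_mul] at h2
    rw [← neg_neg (u * u), h2]
    simp
  obtain ⟨m', rfl⟩ : ∃ m' : E4, m₂ = c • m + d • m' :=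
    ⟨d⁻¹ • (m₂ - c • m), by rw [smul_smul, mul_inv_cancel₀ hd, one_smul]; abel⟩
  have hmr' : m'.re = 0 := by simpa [hmr, hd] using hm₂
  refine ⟨e, u, _, _, isCircularForm_of_rulings (m := m) (m' := m') he huu hur hun hmr hmr' ?_ ?_⟩
  -- If `m - u m'` commutes with `u`, it is `α + β u`. Then the difference of the pedal points lies
  -- in the span of the directions `e` and `e * u`, so the lines are coplanar.
  · intro hcomm
    have hW : ∀ a b : ℝ, a • e + b • (e * u) ∈ Submodule.span ℝ {e, e * u} :=
      fun a b => Submodule.mem_span_pair.2 ⟨a, b, rfl⟩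
    have hnorm : ‖c • e + d • (e * u)‖ ^ 2 = c ^ 2 + d ^ 2 := by
      have : c • e + d • (e * u) = e * (c • (1 : E4) + d • u) := by
        rw [mul_add, mul_smul_comm, mul_smul_comm, mul_one]
      rw [this, norm_mul, he, one_mul, norm_sq_complex hur hun]
    have hcd : c ^ 2 + d ^ 2 ≠ 0 := by positivity
    refine h (coplanar_union_of_pedal_sub_mem hc₁ hc₂ (W := Submodule.span ℝ {e, e * u})
      ?_ ?_ (hW c d) ?_)
    · exact finrank_span_pair_le_two _ _
    · exact Submodule.smul_mem _ _ (Submodule.subset_span (by simp))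
    · rw [hpedal₁, hnorm]
      obtain ⟨α, β, hαβ⟩ : ∃ α β : ℝ, m - u * m' = α • (1 : E4) + β • u :=
        ⟨_, _, mem_complex_of_commute huu hun hcomm⟩
      have hm : m = u * m' + α • (1 : E4) + β • u := by
        rw [add_assoc, ← hαβ]; abel
      have key : e * m - (c ^ 2 + d ^ 2)⁻¹ •
          ((c • e + d • (e * u)) * (c • m + d • m')) =
          (c ^ 2 + d ^ 2)⁻¹ • ((d ^ 2 * α + c * d * β) • e + (d ^ 2 * β - c * d * α) • (e * u)) := by
        have huu' : ∀ x : E4, u * (u * x) = -x := fun x => by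
          rw [← mul_assoc, huu, neg_one_mul]
        have h5 : e * m = (c ^ 2 + d ^ 2)⁻¹ • (c ^ 2 + d ^ 2) • (e * m) := by
          rw [smul_smul, inv_mul_cancel₀ hcd, one_smul]
        rw [h5, ← smul_sub, hm]
        congr 1
        simp only [add_mul, mul_add, smul_mul_assoc, mul_smul_comm, mul_assoc, huu, huu', mul_one,
          mul_neg]
        module
      rw [key]
      exact Submodule.smul_mem _ _ (hW _ _)
  · intro ℓ
    rw [mem_rulings_iff hc₁ hc₂]
    constructor
    · rintro ⟨a, b, hab⟩
      refine ⟨a * r + b * c, b * d, ?_⟩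
      convert hab using 1 <;> module
    · rintro ⟨a, b, hab⟩
      refine ⟨(a - b / d * c) / r, b / d, ?_⟩
      have h1 : (a - b / d * c) / r * r = a - b / d * c := div_mul_cancel₀ _ hr
      have h2 : b / d * d = b := div_mul_cancel₀ _ hd
      convert hab using 1
      · rw [smul_smul, smul_add, smul_smul, smul_smul, h1, h2]; module
      · rw [smul_smul, smul_add, smul_smul, smul_smul, h1, h2]; module

theorem isDisplacement_of_mem_rulings {ℓ₁ ℓ₂ : AffineSubspace ℝ E4} {g : E4 ≃ᵃⁱ[ℝ] E4}
    (hg : g ∈ lineSymmetricMotion (rulings ℓ₁ ℓ₂)) : IsDisplacement g := by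
  obtain ⟨ℓ, ⟨l₁, m₁, l₂, m₂, -, -, a, b, hab⟩, _, rfl⟩ := hg
  refine isDisplacement_halfTurn ?_
  rw [hab.2.1]
  exact finrank_span_singleton hab.1

/-! ### Continuity and perturbation arguments -/

section Perturbation

variable {E : Type*} [NormedAddCommGroup E] [InnerProductSpace ℝ E]

/-- A line meets a sphere in at most two points, and a continuous curve cannot jump between them: by
the intermediate value theorem it would pass through their midpoint. -/
theorem eq_of_continuous_of_line_of_sphere {f : ℝ → E} (hf : Continuous f) {c v : E}
    (hv : ∀ t, ∃ a : ℝ, f t - f 0 = a • v) (hc : ∀ t, ‖f t - c‖ = ‖f 0 - c‖) (t : ℝ) :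
    f t = f 0 := by
  by_cases hv0 : v = 0
  · obtain ⟨a, ha⟩ := hv t
    rw [hv0, smul_zero] at ha
    exact sub_eq_zero.1 ha
  have hvn : ‖v‖ ^ 2 ≠ 0 := by simpa using hv0
  set a : ℝ → ℝ := fun t => inner ℝ (f t - f 0) v / ‖v‖ ^ 2 with ha_def
  have hac : Continuous a := by rw [ha_def]; fun_prop
  have ha : ∀ t, f t - f 0 = a t • v := by
    intro t
    obtain ⟨b, hb⟩ := hv t
    have : a t = b := by
      rw [ha_def]
      simp only [hb, inner_smul_left, real_inner_self_eq_norm_sq, conj_trivial]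
      field_simp
    rw [this, hb]
  have hq : ∀ t, a t * (a t * ‖v‖ ^ 2 + 2 * inner ℝ v (f 0 - c)) = 0 := by
    intro t
    have h1 : f t - c = a t • v + (f 0 - c) := by rw [← ha]; abel
    have h2 := congrArg (· ^ 2) (hc t)
    simp only [h1] at h2
    rw [norm_add_sq_real, norm_smul, inner_smul_left, mul_pow, Real.norm_eq_abs, sq_abs] at h2
    simp only [conj_trivial] at h2
    linear_combination h2
  by_contra hne
  have hat : a t ≠ 0 := by
    intro h0
    have := ha t
    rw [h0, zero_smul] at this
    exact hne (sub_eq_zero.1 this)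
  have ha0 : a 0 = 0 := by simp [ha_def]
  obtain ⟨s, hs⟩ : (1 / 2 : ℝ) ∈ Set.range fun s => a s / a t :=
    mem_range_of_exists_le_of_exists_ge (by fun_prop) ⟨0, by simp [ha0]⟩
      ⟨t, by simp only [div_self hat]; norm_num⟩
  have hs' : a s = a t / 2 := by
    have : a s / a t = 1 / 2 := hs
    field_simp at this
    linarith
  have h1 := hq s
  have h2 := (mul_eq_zero.1 (hq t)).resolve_left hat
  rw [hs'] at h1
  have h3 := (mul_eq_zero.1 h1).resolve_left (div_ne_zero hat two_ne_zero)
  have h4 : a t * ‖v‖ ^ 2 = 0 := by linarith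
  exact (mul_ne_zero hat hvn) h4

theorem mem_span_pair_of_mem [FiniteDimensional ℝ E] {W : Submodule ℝ E}
    (hW : Module.finrank ℝ W ≤ 2) {u₁ u₂ w : E}
    (h : LinearIndependent ℝ ![u₁, u₂]) (h₁ : u₁ ∈ W) (h₂ : u₂ ∈ W) (hw : w ∈ W) :
    w ∈ Submodule.span ℝ {u₁, u₂} := by
  have hle : Submodule.span ℝ {u₁, u₂} ≤ W := by
    rw [Submodule.span_le]
    rintro x (rfl | rfl)
    exacts [h₁, h₂]
  have h3 : Module.finrank ℝ (Submodule.span ℝ {u₁, u₂}) = 2 := by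
    rw [← Matrix.range_cons_cons_empty u₁ u₂ ![], finrank_span_eq_card h, Fintype.card_fin]
  rw [Submodule.eq_of_le_of_finrank_le hle (by rw [h3]; exact hW)]
  exact hw

theorem linearIndependent_triple_iff {w u₁ u₂ : E} :
    LinearIndependent ℝ ![w, u₁, u₂] ↔
      LinearIndependent ℝ ![u₁, u₂] ∧ w ∉ Submodule.span ℝ {u₁, u₂} := by
  rw [← Matrix.range_cons_cons_empty u₁ u₂ ![]]
  exact linearIndependent_finCons

/-- Linear independence of a triple is an open condition, so dependence of the perturbed triples
passes to the limit `ε → 0`. -/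
theorem mem_span_pair_of_perturbation [FiniteDimensional ℝ E] {u₁ u₂ w v₁ v₂ w' : E}
    (h : ∀ ε : ℝ, ε ≠ 0 → LinearIndependent ℝ ![u₁ + ε • v₁, u₂ + ε • v₂] →
      w + ε • w' ∈ Submodule.span ℝ {u₁ + ε • v₁, u₂ + ε • v₂})
    (hu : LinearIndependent ℝ ![u₁, u₂]) : w ∈ Submodule.span ℝ {u₁, u₂} := by
  by_contra hw
  have h1 : LinearIndependent ℝ ![w, u₁, u₂] := linearIndependent_triple_iff.2 ⟨hu, hw⟩
  have h2 : Filter.Tendsto (fun ε : ℝ => ![w + ε • w', u₁ + ε • v₁, u₂ + ε • v₂]) (nhds 0)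
      (nhds ![w, u₁, u₂]) := by
    have hc : Continuous (fun ε : ℝ => ![w + ε • w', u₁ + ε • v₁, u₂ + ε • v₂]) := by
      refine continuous_pi fun i => ?_
      fin_cases i <;> simp <;> fun_prop
    simpa using hc.tendsto 0
  have h3 := (h2.eventually h1.eventually).filter_mono (nhdsWithin_le_nhds (s := {0}ᶜ))
  obtain ⟨ε, h4, h5⟩ := (h3.and self_mem_nhdsWithin).exists
  obtain ⟨h6, h7⟩ := linearIndependent_triple_iff.1 h4
  exact h7 (h ε h5 h6)

theorem exists_smul_of_not_linearIndependent {u : ℝ → E}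
    (h : ∀ s t, ¬ LinearIndependent ℝ ![u s, u t]) : ∃ v, ∀ t, ∃ a : ℝ, u t = a • v := by
  by_cases h0 : ∀ t, u t = 0
  · exact ⟨0, fun t => ⟨0, by rw [h0, smul_zero]⟩⟩
  · push Not at h0
    obtain ⟨s, hs⟩ := h0
    refine ⟨u s, fun t => ?_⟩
    have := h s t
    rw [LinearIndependent.pair_iff' hs] at this
    push Not at this
    obtain ⟨a, ha⟩ := this
    exact ⟨a, ha.symm⟩

end Perturbation

/-! ### Fixed spaces of rotations of 4-space -/

section Determinant

theorem det_reflection_orthogonal_singleton {v : E4} (hv : v ≠ 0) :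
    LinearMap.det (Submodule.span ℝ {v})ᗮ.reflection.toLinearMap = -1 := by
  rw [Submodule.det_reflection, Submodule.orthogonal_orthogonal, finrank_span_singleton hv, pow_one]

theorem reflection_orthogonal_zero :
    (Submodule.span ℝ {(0 : E4)})ᗮ.reflection = 1 := by
  ext1 x
  exact Submodule.reflection_mem_subspace_eq_self (by simp)

theorem reflection_orthogonal_apply_of_mem {W : Submodule ℝ E4} {v x : E4} (hv : v ∈ W)
    (hx : x ∈ Wᗮ) : (Submodule.span ℝ {v})ᗮ.reflection x = x := by
  apply Submodule.reflection_mem_subspace_eq_self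
  exact Submodule.orthogonal_le ((Submodule.span_singleton_le_iff_mem _ _).2 hv) hx

theorem exists_reflections (φ : E4 ≃ₗᵢ[ℝ] E4) {K : Submodule ℝ E4} (hK : ∀ x ∈ K, φ x = x) {n : ℕ}
    (hn : 4 ≤ Module.finrank ℝ K + n) :
    ∃ l : List E4, l.length ≤ n ∧
      φ = (l.map fun v => (Submodule.span ℝ {v})ᗮ.reflection).prod := by
  apply φ.reflections_generate_dim_aux
  set N := (ContinuousLinearMap.id ℝ E4 - (φ : E4 →L[ℝ] E4)).ker with hN
  have h1 : K ≤ N := by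
    intro x hx
    rw [hN, LinearMap.mem_ker]
    simp [hK x hx]
  have h2 := Submodule.finrank_mono h1
  have h3 := N.finrank_add_finrank_orthogonal
  rw [Quaternion.finrank_eq_four] at h3
  omega

/-- An isometry fixing a 3-space is a product of at most one reflection, and a genuine reflection
has determinant `-1`. -/
theorem eq_one_of_det_eq_one {φ : E4 ≃ₗᵢ[ℝ] E4}
    (hdet : LinearMap.det (φ.toLinearEquiv : E4 →ₗ[ℝ] E4) = 1) {K : Submodule ℝ E4}
    (hK : ∀ x ∈ K, φ x = x) (hn : 3 ≤ Module.finrank ℝ K) : φ = 1 := by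
  obtain ⟨l, hl, rfl⟩ := exists_reflections φ hK (n := 1) (by omega)
  match l, hl with
  | [], _ => rfl
  | [v], _ =>
    by_cases hv : v = 0
    · simp only [hv, List.map_cons, List.map_nil, List.prod_cons, List.prod_nil,
        reflection_orthogonal_zero, mul_one]
    · have h1 := det_reflection_orthogonal_singleton hv
      simp only [List.map_cons, List.map_nil, List.prod_cons, List.prod_nil, mul_one] at hdet
      exact absurd (h1.symm.trans hdet) (by norm_num)

/-- A fixed vector leaves at most three reflections, and determinant `1` excludes three genuine
ones. Two reflections fix the orthogonal complement of their normals. -/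
theorem exists_fixed_plane_of_det_eq_one {φ : E4 ≃ₗᵢ[ℝ] E4}
    (hdet : LinearMap.det (φ.toLinearEquiv : E4 →ₗ[ℝ] E4) = 1) {K : Submodule ℝ E4}
    (hK : ∀ x ∈ K, φ x = x) (hn : 1 ≤ Module.finrank ℝ K) :
    ∃ N : Submodule ℝ E4, 2 ≤ Module.finrank ℝ N ∧ ∀ x ∈ N, φ x = x := by
  have key : ∀ a b : E4,
      φ = (Submodule.span ℝ {a})ᗮ.reflection * (Submodule.span ℝ {b})ᗮ.reflection →
      ∃ N : Submodule ℝ E4, 2 ≤ Module.finrank ℝ N ∧ ∀ x ∈ N, φ x = x := by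
    rintro a b rfl
    refine ⟨(Submodule.span ℝ {a, b})ᗮ, ?_, fun x hx => ?_⟩
    · have h1 := (Submodule.span ℝ {a, b}).finrank_add_finrank_orthogonal
      have h2 := finrank_span_pair_le_two a b
      rw [Quaternion.finrank_eq_four] at h1
      omega
    · rw [LinearIsometryEquiv.coe_mul, Function.comp_apply,
        reflection_orthogonal_apply_of_mem (Submodule.subset_span (by simp)) hx,
        reflection_orthogonal_apply_of_mem (Submodule.subset_span (by simp)) hx]
  obtain ⟨l, hl, hφ⟩ := exists_reflections φ hK (n := 3) (by omega)
  match l, hl with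
  -- The normal `0` stands for the identity and pads short products.
  | [], _ => exact key 0 0 (by rw [hφ, reflection_orthogonal_zero]; rfl)
  | [a], _ => exact key a 0 (by rw [hφ, reflection_orthogonal_zero]; rfl)
  | [a, b], _ => exact key a b (by rw [hφ]; simp)
  | [a, b, c], _ =>
    simp only [List.map_cons, List.map_nil, List.prod_cons, List.prod_nil, mul_one] at hφ
    by_cases ha : a = 0
    · exact key b c (by rw [hφ, ha, reflection_orthogonal_zero, one_mul])
    by_cases hb : b = 0
    · exact key a c (by rw [hφ, hb, reflection_orthogonal_zero, one_mul])
    by_cases hc : c = 0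
    · exact key a b (by rw [hφ, hc, reflection_orthogonal_zero, mul_one])
    have h1 : (φ.toLinearEquiv : E4 →ₗ[ℝ] E4) = (Submodule.span ℝ {a})ᗮ.reflection.toLinearMap ∘ₗ
        (Submodule.span ℝ {b})ᗮ.reflection.toLinearMap ∘ₗ
        (Submodule.span ℝ {c})ᗮ.reflection.toLinearMap := by
      rw [hφ]
      rfl
    rw [h1, LinearMap.det_comp, LinearMap.det_comp, det_reflection_orthogonal_singleton ha,
      det_reflection_orthogonal_singleton hb, det_reflection_orthogonal_singleton hc] at hdet
    norm_num at hdet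

end Determinant

/-! ### A common fixed plane of the linear parts -/

/-- A one-parameter motion that starts at the identity, is neither spherical nor a pure
translation, and moves every point in a plane and on a sphere. -/
structure IsCircularMotion (h : ℝ → (E4 ≃ᵃⁱ[ℝ] E4)) : Prop where
  continuous : ∀ x, Continuous fun t => h t x
  zero : ∀ x, h 0 x = x
  isDisplacement : ∀ t, IsDisplacement (h t)
  planar : ∀ x, ∃ W : Submodule ℝ E4, Module.finrank ℝ W ≤ 2 ∧ ∀ t, h t x - x ∈ W
  spherical : ∀ x, ∃ c, ∀ t, ‖h t x - c‖ = ‖x - c‖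
  exists_ne : ∀ x, ∃ t, h t x ≠ x
  exists_linear_ne : ∃ t, (h t).linearIsometryEquiv ≠ 1

namespace IsCircularMotion

variable {h : ℝ → (E4 ≃ᵃⁱ[ℝ] E4)}

theorem apply_add (g : E4 ≃ᵃⁱ[ℝ] E4) (x y : E4) : g (x + y) = g x + g.linearIsometryEquiv y := by
  have := g.map_vadd x y
  rw [vadd_eq_add, vadd_eq_add, add_comm y, add_comm _ (g x)] at this
  exact this

theorem apply_eq (g : E4 ≃ᵃⁱ[ℝ] E4) (x : E4) : g x = g 0 + g.linearIsometryEquiv x := by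
  rw [← apply_add, zero_add]

theorem displacement_add (g : E4 ≃ᵃⁱ[ℝ] E4) (x y : E4) (ε : ℝ) :
    g (x + ε • y) - (x + ε • y) = (g x - x) + ε • (g.linearIsometryEquiv y - y) := by
  rw [apply_add, map_smul, smul_sub]
  abel

theorem linear_zero (H : IsCircularMotion h) : (h 0).linearIsometryEquiv = 1 := by
  ext1 x
  have := apply_eq (h 0) x
  rw [H.zero, H.zero, zero_add] at this
  exact this.symm

theorem not_mem_line (H : IsCircularMotion h) (x v : E4) :
    ¬ ∀ t, ∃ a : ℝ, h t x - x = a • v := by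
  intro hv
  obtain ⟨c, hc⟩ := H.spherical x
  obtain ⟨t, ht⟩ := H.exists_ne x
  have := eq_of_continuous_of_line_of_sphere (H.continuous x) (v := v) (c := c)
    (by simpa only [H.zero] using hv) (by simpa only [H.zero] using hc) t
  rw [H.zero] at this
  exact ht this

theorem exists_linearIndependent (H : IsCircularMotion h) (x : E4) :
    ∃ t₁ t₂, LinearIndependent ℝ ![h t₁ x - x, h t₂ x - x] := by
  by_contra! hcon
  obtain ⟨v, hv⟩ := exists_smul_of_not_linearIndependent (u := fun t => h t x - x) hcon
  exact H.not_mem_line x v hv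

theorem mem_span_pair (H : IsCircularMotion h) {x : E4} {t₁ t₂ : ℝ}
    (hx : LinearIndependent ℝ ![h t₁ x - x, h t₂ x - x]) (t : ℝ) :
    h t x - x ∈ Submodule.span ℝ {h t₁ x - x, h t₂ x - x} := by
  obtain ⟨W, hW, hm⟩ := H.planar x
  exact mem_span_pair_of_mem hW hx (hm _) (hm _) (hm _)

/-- A combination of displacements that vanishes at a point `x` takes all its values in the plane
of the trajectory of `x`. -/
theorem linear_comb_mem_span_pair (H : IsCircularMotion h) {x : E4} {t₁ t₂ : ℝ}
    (hx : LinearIndependent ℝ ![h t₁ x - x, h t₂ x - x]) {t a b : ℝ}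
    (hab : h t x - x = a • (h t₁ x - x) + b • (h t₂ x - x)) (y : E4) :
    ((h t).linearIsometryEquiv y - y) - a • ((h t₁).linearIsometryEquiv y - y) -
      b • ((h t₂).linearIsometryEquiv y - y) ∈
      Submodule.span ℝ {h t₁ x - x, h t₂ x - x} := by
  -- At `x + ε • y` the combination equals `ε` times its linear part at `y`. It lies in the
  -- trajectory plane of that point; divide by `ε` and let `ε → 0`.
  refine mem_span_pair_of_perturbation (v₁ := (h t₁).linearIsometryEquiv y - y)
    (v₂ := (h t₂).linearIsometryEquiv y - y) (w' := 0) (fun ε hε hli => ?_) hx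
  rw [smul_zero, add_zero]
  obtain ⟨W, hW, hm⟩ := H.planar (x + ε • y)
  have h1 := hm t₁
  have h2 := hm t₂
  have h3 := hm t
  rw [displacement_add] at h1 h2 h3
  refine mem_span_pair_of_mem hW hli h1 h2 ?_
  have h4 := W.smul_mem ε⁻¹ (W.sub_mem (W.sub_mem h3 (W.smul_mem a h1)) (W.smul_mem b h2))
  convert h4 using 1
  rw [hab]
  match_scalars <;> field_simp <;> ring

/-- Otherwise `A - 1`, with `A` the linear part of `h s`, is bijective and `h s` fixes some point
`x`. Then `linear_comb_mem_span_pair` with zero coefficients puts the whole image of `A - 1` into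
the trajectory plane of `x`, although that image has dimension four. -/
theorem exists_linear_fixed (H : IsCircularMotion h) (s : ℝ) :
    ∃ v : E4, v ≠ 0 ∧ (h s).linearIsometryEquiv v = v := by
  by_contra! hcon
  set B : E4 →ₗ[ℝ] E4 :=
    ((h s).linearIsometryEquiv.toLinearEquiv : E4 →ₗ[ℝ] E4) - LinearMap.id with hB
  have hBa : ∀ y, B y = (h s).linearIsometryEquiv y - y := fun y => rfl
  have hinj : Function.Injective B := by
    rw [← LinearMap.ker_eq_bot, LinearMap.ker_eq_bot']
    intro v hv
    by_contra hv0
    exact hcon v hv0 (sub_eq_zero.1 hv)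
  have hsurj := LinearMap.injective_iff_surjective.1 hinj
  obtain ⟨x, hx⟩ := hsurj (-(h s 0))
  have hfix : h s x - x = 0 := by
    rw [apply_eq, add_sub_assoc, ← hBa, hx, add_neg_cancel]
  obtain ⟨t₁, t₂, hli⟩ := H.exists_linearIndependent x
  have hle : (⊤ : Submodule ℝ E4) ≤ Submodule.span ℝ {h t₁ x - x, h t₂ x - x} := by
    intro z _
    obtain ⟨y, rfl⟩ := hsurj z
    have := H.linear_comb_mem_span_pair hli (t := s) (a := 0) (b := 0) (by simpa using hfix) y
    rwa [zero_smul, zero_smul, sub_zero, sub_zero, ← hBa] at this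
  have h1 := Submodule.finrank_mono hle
  have h2 := finrank_span_pair_le_two (h t₁ x - x) (h t₂ x - x)
  rw [finrank_top, Quaternion.finrank_eq_four] at h1
  omega

/-- Planarity passes to the linear parts by looking from afar: the trajectory of `ε⁻¹ • x`, scaled
by `ε`, tends to that of `x` under the linear parts. -/
theorem linear_mem_span_pair (H : IsCircularMotion h) {x : E4} {t₁ t₂ : ℝ}
    (hx : LinearIndependent ℝ ![(h t₁).linearIsometryEquiv x - x,
      (h t₂).linearIsometryEquiv x - x]) (t : ℝ) :
    (h t).linearIsometryEquiv x - x ∈ Submodule.span ℝ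
      {(h t₁).linearIsometryEquiv x - x, (h t₂).linearIsometryEquiv x - x} := by
  refine mem_span_pair_of_perturbation (v₁ := h t₁ 0) (v₂ := h t₂ 0) (w' := h t 0)
    (fun ε hε hli => ?_) hx
  obtain ⟨W, hW, hm⟩ := H.planar (ε⁻¹ • x)
  have key : ∀ t, (h t).linearIsometryEquiv x - x + ε • h t 0 ∈ W := by
    intro t
    have h1 := W.smul_mem ε (hm t)
    rw [apply_eq, map_smul] at h1
    convert h1 using 1
    match_scalars <;> field_simp
  exact mem_span_pair_of_mem hW hli (key _) (key _) (key _)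

theorem linear_mem_span_pair_of_fixed (H : IsCircularMotion h) {x : E4} {t₁ t₂ s : ℝ}
    (hx : LinearIndependent ℝ ![(h t₁).linearIsometryEquiv x - x,
      (h t₂).linearIsometryEquiv x - x]) (hs : (h s).linearIsometryEquiv x = x) (y : E4) :
    (h s).linearIsometryEquiv y - y ∈ Submodule.span ℝ
      {(h t₁).linearIsometryEquiv x - x, (h t₂).linearIsometryEquiv x - x} := by
  refine mem_span_pair_of_perturbation (v₁ := (h t₁).linearIsometryEquiv y - y)
    (v₂ := (h t₂).linearIsometryEquiv y - y) (w' := 0) (fun ε hε hli => ?_) hx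
  have key : ∀ t, (h t).linearIsometryEquiv (x + ε • y) - (x + ε • y) =
      (h t).linearIsometryEquiv x - x + ε • ((h t).linearIsometryEquiv y - y) := by
    intro t
    rw [map_add, map_smul, smul_sub]
    abel
  rw [← key, ← key] at hli
  have h1 := H.linear_mem_span_pair hli s
  rw [key, key, key, hs, sub_self, zero_add] at h1
  rw [smul_zero, add_zero]
  exact (Submodule.smul_mem_iff _ hε).1 h1

theorem continuous_linear (H : IsCircularMotion h) (x : E4) :
    Continuous fun t => (h t).linearIsometryEquiv x := by
  have : (fun t => (h t).linearIsometryEquiv x) = fun t => h t x - h t 0 := by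
    ext1 t
    rw [apply_eq (h t) x, add_sub_cancel_left]
  rw [this]
  exact (H.continuous x).sub (H.continuous 0)

/-- Let `A ≠ 1` be one linear part; its fixed space is a plane. If a vector `x` of it had a
genuinely planar orbit under the linear parts, the orbit plane would be the image of `A - 1`, which
is orthogonal to `x`; this is impossible for vectors of constant norm. So the orbit lies on a line
and a sphere, hence is constant. -/
theorem exists_fixed_plane (H : IsCircularMotion h) :
    ∃ N : Submodule ℝ E4, Module.finrank ℝ N = 2 ∧
      ∀ t, ∀ x ∈ N, (h t).linearIsometryEquiv x = x := by
  obtain ⟨s, hs⟩ := H.exists_linear_ne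
  set B : E4 →ₗ[ℝ] E4 :=
    ((h s).linearIsometryEquiv.toLinearEquiv : E4 →ₗ[ℝ] E4) - LinearMap.id with hB
  have hBa : ∀ y, B y = (h s).linearIsometryEquiv y - y := fun y => rfl
  have hker : ∀ y, y ∈ LinearMap.ker B ↔ (h s).linearIsometryEquiv y = y := fun y => by
    rw [LinearMap.mem_ker, hBa, sub_eq_zero]
  have hle : Module.finrank ℝ (LinearMap.ker B) ≤ 2 := by
    by_contra! hlt
    exact hs (eq_one_of_det_eq_one (H.isDisplacement s) (fun x hx => (hker x).1 hx) hlt)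
  have hge : 2 ≤ Module.finrank ℝ (LinearMap.ker B) := by
    obtain ⟨v, hv0, hv⟩ := H.exists_linear_fixed s
    obtain ⟨N, hN, hfix⟩ := exists_fixed_plane_of_det_eq_one (H.isDisplacement s)
      (K := Submodule.span ℝ {v}) (fun x hx => by
        obtain ⟨a, rfl⟩ := Submodule.mem_span_singleton.1 hx
        rw [map_smul, hv]) (finrank_span_singleton hv0).ge
    exact hN.trans (Submodule.finrank_mono fun x hx => (hker x).2 (hfix x hx))
  have hrange : Module.finrank ℝ (LinearMap.range B) = 2 := by
    have := LinearMap.finrank_range_add_finrank_ker B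
    rw [Quaternion.finrank_eq_four] at this
    omega
  refine ⟨LinearMap.ker B, le_antisymm hle hge, fun t x hx => ?_⟩
  have hx' := (hker x).1 hx
  have hlin : ∀ t₁ t₂, ¬ LinearIndependent ℝ ![(h t₁).linearIsometryEquiv x - x,
      (h t₂).linearIsometryEquiv x - x] := by
    intro t₁ t₂ hli
    have h1 : LinearMap.range B ≤ Submodule.span ℝ
        {(h t₁).linearIsometryEquiv x - x, (h t₂).linearIsometryEquiv x - x} := by
      rintro _ ⟨y, rfl⟩
      exact H.linear_mem_span_pair_of_fixed hli hx' y
    have h2 := Submodule.eq_of_le_of_finrank_le h1 (by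
      rw [hrange]; exact finrank_span_pair_le_two _ _)
    obtain ⟨y, hy⟩ : (h t₁).linearIsometryEquiv x - x ∈ LinearMap.range B := by
      rw [h2]; exact Submodule.subset_span (by simp)
    have h3 : inner ℝ x ((h t₁).linearIsometryEquiv x - x) = 0 := by
      rw [← hy, hBa, inner_sub_right]
      nth_rewrite 1 [← hx']
      rw [LinearIsometryEquiv.inner_map_map, sub_self]
    have h4 : ‖x + ((h t₁).linearIsometryEquiv x - x)‖ ^ 2 = ‖x‖ ^ 2 := by
      rw [add_sub_cancel, LinearIsometryEquiv.norm_map]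
    rw [norm_add_sq_real, h3] at h4
    have h5 : ‖(h t₁).linearIsometryEquiv x - x‖ ^ 2 = 0 := by linarith
    exact hli.ne_zero 0 (by simpa using h5)
  obtain ⟨v, hv⟩ := exists_smul_of_not_linearIndependent hlin
  have h0 : (h 0).linearIsometryEquiv x = x := by rw [H.linear_zero]; rfl
  have := eq_of_continuous_of_line_of_sphere (H.continuous_linear x) (c := 0) (v := v)
    (by simpa only [h0] using hv) (by simp) t
  rw [this, h0]

end IsCircularMotion

/-! ### Complex coordinates adapted to the fixed plane -/

/-- The point of `E4` with the complex coordinates `z = x₁ + x₃ i` and `w = x₀ + x₂ i`. -/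
def complexPoint (z w : ℂ) : E4 := ⟨w.re, z.re, w.im, z.im⟩

section ComplexPoint

theorem re_complexPoint (z w : ℂ) : (complexPoint z w).re = w.re := rfl

theorem imI_complexPoint (z w : ℂ) : (complexPoint z w).imI = z.re := rfl

theorem imJ_complexPoint (z w : ℂ) : (complexPoint z w).imJ = w.im := rfl

theorem imK_complexPoint (z w : ℂ) : (complexPoint z w).imK = z.im := rfl

theorem complexPoint_add (z w z' w' : ℂ) :
    complexPoint z w + complexPoint z' w' = complexPoint (z + z') (w + w') := rfl

theorem complexPoint_sub (z w z' w' : ℂ) :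
    complexPoint z w - complexPoint z' w' = complexPoint (z - z') (w - w') := rfl

theorem complexPoint_zero : complexPoint 0 0 = 0 := rfl

theorem smul_complexPoint (a : ℝ) (z w : ℂ) :
    a • complexPoint z w = complexPoint (a * z) (a * w) := by
  ext <;> simp [re_complexPoint, imI_complexPoint, imJ_complexPoint,
    imK_complexPoint]

theorem norm_complexPoint_sq (z w : ℂ) :
    ‖complexPoint z w‖ ^ 2 = Complex.normSq z + Complex.normSq w := by
  rw [sq, ← Quaternion.normSq_eq_norm_mul_self, Quaternion.normSq_def', Complex.normSq_apply,
    Complex.normSq_apply]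
  simp only [complexPoint]
  ring

theorem inner_complexPoint (z w z' w' : ℂ) :
    inner ℝ (complexPoint z w) (complexPoint z' w') =
      (z * (starRingEnd ℂ) z').re + (w * (starRingEnd ℂ) w').re := by
  rw [Quaternion.inner_def]
  simp [re_complexPoint, imI_complexPoint, imJ_complexPoint,
    imK_complexPoint]
  ring

theorem complexPoint_inj {z w z' w' : ℂ} :
    complexPoint z w = complexPoint z' w' ↔ z = z' ∧ w = w' := by
  constructor
  · intro h
    have h0 := congrArg QuaternionAlgebra.re h
    have h1 := congrArg QuaternionAlgebra.imI h
    have h2 := congrArg QuaternionAlgebra.imJ h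
    have h3 := congrArg QuaternionAlgebra.imK h
    exact ⟨Complex.ext h1 h3, Complex.ext h0 h2⟩
  · rintro ⟨rfl, rfl⟩
    rfl

theorem exists_eq_complexPoint (x : E4) : ∃ z w, x = complexPoint z w :=
  ⟨⟨x.imI, x.imK⟩, ⟨x.re, x.imJ⟩, rfl⟩

/-- The inclusion of the plane `w = 0`. -/
def planeZ : ℂ →ₗᵢ[ℝ] E4 where
  toFun z := complexPoint z 0
  map_add' z z' := by rw [complexPoint_add, add_zero]
  map_smul' a z := by simp [smul_complexPoint]
  norm_map' z := by
    have h : ‖complexPoint z 0‖ ^ 2 = ‖z‖ ^ 2 := by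
      rw [norm_complexPoint_sq, map_zero, add_zero, Complex.normSq_eq_norm_sq]
    exact (sq_eq_sq₀ (norm_nonneg _) (norm_nonneg _)).1 h

/-- The inclusion of the plane `z = 0`. -/
def planeW : ℂ →ₗᵢ[ℝ] E4 where
  toFun w := complexPoint 0 w
  map_add' z z' := by rw [complexPoint_add, add_zero]
  map_smul' a z := by simp [smul_complexPoint]
  norm_map' w := by
    have h : ‖complexPoint 0 w‖ ^ 2 = ‖w‖ ^ 2 := by
      rw [norm_complexPoint_sq, map_zero, zero_add, Complex.normSq_eq_norm_sq]
    exact (sq_eq_sq₀ (norm_nonneg _) (norm_nonneg _)).1 h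

theorem finrank_range_planeZ : Module.finrank ℝ (LinearMap.range planeZ.toLinearMap) = 2 := by
  rw [LinearMap.finrank_range_of_inj planeZ.injective, Complex.finrank_real_complex]

theorem finrank_range_planeW : Module.finrank ℝ (LinearMap.range planeW.toLinearMap) = 2 := by
  rw [LinearMap.finrank_range_of_inj planeW.injective, Complex.finrank_real_complex]

theorem exists_isometry_planeW {N : Submodule ℝ E4} (hN : Module.finrank ℝ N = 2) :
    ∃ F : E4 ≃ₗᵢ[ℝ] E4, ∀ w, F (complexPoint 0 w) ∈ N := by
  let e := (stdOrthonormalBasis ℝ (LinearMap.range planeW.toLinearMap)).equiv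
    (stdOrthonormalBasis ℝ N) (finCongr (finrank_range_planeW.trans hN.symm))
  refine ⟨(N.subtypeₗᵢ.comp e.toLinearIsometry).extend.toLinearIsometryEquiv rfl, fun w => ?_⟩
  have h := (N.subtypeₗᵢ.comp e.toLinearIsometry).extend_apply ⟨complexPoint 0 w, w, rfl⟩
  change (N.subtypeₗᵢ.comp e.toLinearIsometry).extend (complexPoint 0 w) ∈ N
  rw [h]
  exact (e _).2

end ComplexPoint

theorem exists_rotation_of_fixed {A : E4 ≃ₗᵢ[ℝ] E4}
    (hdet : LinearMap.det (A.toLinearEquiv : E4 →ₗ[ℝ] E4) = 1)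
    (hA : ∀ w, A (complexPoint 0 w) = complexPoint 0 w) :
    ∃ p : ℂ, ‖p‖ = 1 ∧ ∀ z, A (complexPoint z 0) = complexPoint (p * z) 0 := by
  have hex : ∀ z, ∃ z', A (complexPoint z 0) = complexPoint z' 0 := by
    intro z
    obtain ⟨z', w', h⟩ := exists_eq_complexPoint (A (complexPoint z 0))
    refine ⟨z', ?_⟩
    have h1 : inner ℝ (A (complexPoint z 0)) (A (complexPoint 0 w')) = 0 := by
      rw [LinearIsometryEquiv.inner_map_map, inner_complexPoint]
      simp
    rw [hA, h, inner_complexPoint, Complex.mul_conj] at h1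
    have h2 : w' = 0 := by simpa using h1
    rw [h, h2]
  choose f hf using hex
  let f' : ℂ →ₗᵢ[ℝ] ℂ :=
    { toFun := f
      map_add' := fun z z' => by
        have h1 : complexPoint (f (z + z')) 0 = complexPoint (f z + f z') (0 + 0) := by
          rw [← hf, ← complexPoint_add, ← hf, ← hf, ← map_add, complexPoint_add, add_zero]
        exact (complexPoint_inj.1 h1).1
      map_smul' := fun a z => by
        have h1 : complexPoint (f (a • z)) 0 = complexPoint (a * f z) (a * 0) := by
          rw [← hf, ← smul_complexPoint, ← hf, ← map_smul, smul_complexPoint, mul_zero,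
            Complex.real_smul]
        exact (complexPoint_inj.1 h1).1
      norm_map' := fun z => by
        have h1 := A.norm_map (complexPoint z 0)
        rw [hf] at h1
        have h2 : ∀ z, ‖complexPoint z 0‖ = ‖z‖ := planeZ.norm_map
        rw [h2, h2] at h1
        exact h1 }
  obtain ⟨a, ha | ha⟩ := linear_isometry_complex (f'.toLinearIsometryEquiv rfl)
  · refine ⟨a, Circle.norm_coe a, fun z => ?_⟩
    have h1 := congrArg (fun g => g z) ha
    have h2 : f z = a * z := h1
    rw [hf, h2]
  · have h2 : ∀ z, f z = a * (starRingEnd ℂ) z := fun z => congrArg (fun g => g z) ha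
    -- The reflection `z ↦ a z̄` fixes a square root `c` of `a`. Together with the plane `z = 0`
    -- this gives a fixed space of dimension three, so determinant `1` forces the identity.
    obtain ⟨c, hc⟩ := IsAlgClosed.exists_pow_nat_eq (a : ℂ) (n := 2) (by norm_num)
    have hc0 : c ≠ 0 := by
      rintro rfl
      have := Circle.norm_coe a
      rw [← hc] at this
      simp at this
    have hcn : c * (starRingEnd ℂ) c = 1 := by
      have h3 : ‖c‖ ^ 2 = 1 := by rw [← norm_pow, hc, Circle.norm_coe]
      rw [Complex.mul_conj, Complex.normSq_eq_norm_sq, h3, Complex.ofReal_one]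
    have hfc : f c = c := by rw [h2, ← hc, sq, mul_assoc, hcn, mul_one]
    have hlt : LinearMap.range planeW.toLinearMap <
        LinearMap.ker ((A.toLinearEquiv : E4 →ₗ[ℝ] E4) - LinearMap.id) := by
      refine lt_of_le_of_ne ?_ ?_
      · rintro _ ⟨w, rfl⟩
        exact sub_eq_zero.2 (hA w)
      · intro heq
        have h3 : complexPoint c 0 ∈
            LinearMap.ker ((A.toLinearEquiv : E4 →ₗ[ℝ] E4) - LinearMap.id) := by
          have h4 : A (complexPoint c 0) = complexPoint c 0 := by rw [hf, hfc]
          exact sub_eq_zero.2 h4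
        rw [← heq] at h3
        obtain ⟨w, hw⟩ := h3
        exact hc0 (complexPoint_inj.1 (show complexPoint 0 w = complexPoint c 0 from hw)).1.symm
    have h3 := Submodule.finrank_lt_finrank_of_lt hlt
    rw [finrank_range_planeW] at h3
    have h4 := eq_one_of_det_eq_one hdet (fun x hx => sub_eq_zero.1 hx) h3
    refine ⟨1, by simp, fun z => ?_⟩
    rw [h4, one_mul]
    rfl

namespace IsCircularMotion

variable {h : ℝ → (E4 ≃ᵃⁱ[ℝ] E4)}

theorem conj (H : IsCircularMotion h) (F : E4 ≃ₗᵢ[ℝ] E4) : IsCircularMotion fun t =>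
    F.toAffineIsometryEquiv.trans ((h t).trans F.symm.toAffineIsometryEquiv) := by
  have happ : ∀ t x, (F.toAffineIsometryEquiv.trans ((h t).trans F.symm.toAffineIsometryEquiv)) x =
      F.symm (h t (F x)) := fun t x => rfl
  have hlin : ∀ t x, (F.toAffineIsometryEquiv.trans
      ((h t).trans F.symm.toAffineIsometryEquiv)).linearIsometryEquiv x =
      F.symm ((h t).linearIsometryEquiv (F x)) := fun t x => rfl
  refine ⟨fun x => ?_, fun x => ?_, fun t => ?_, fun x => ?_, fun x => ?_, fun x => ?_, ?_⟩
  · simp_rw [happ]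
    exact F.symm.continuous.comp (H.continuous _)
  · rw [happ, H.zero, F.symm_apply_apply]
  · have h1 : ((F.toAffineIsometryEquiv.trans
        ((h t).trans F.symm.toAffineIsometryEquiv)).linearIsometryEquiv.toLinearEquiv :
        E4 →ₗ[ℝ] E4) = (F.symm.toLinearEquiv : E4 →ₗ[ℝ] E4) ∘ₗ
        ((h t).linearIsometryEquiv.toLinearEquiv : E4 →ₗ[ℝ] E4) ∘ₗ
        (F.symm.toLinearEquiv.symm : E4 →ₗ[ℝ] E4) := by
      ext1 x
      rfl
    rw [IsDisplacement, h1, LinearMap.det_conj]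
    exact H.isDisplacement t
  · obtain ⟨W, hW, hm⟩ := H.planar (F x)
    refine ⟨W.map (F.symm.toLinearEquiv : E4 →ₗ[ℝ] E4), ?_, fun t => ?_⟩
    · rw [LinearEquiv.finrank_map_eq]
      exact hW
    · refine ⟨_, hm t, ?_⟩
      change F.symm (h t (F x) - F x) = _
      rw [happ, map_sub, F.symm_apply_apply]
  · obtain ⟨c, hc⟩ := H.spherical (F x)
    refine ⟨F.symm c, fun t => ?_⟩
    rw [happ, ← map_sub, F.symm.norm_map, hc, ← F.symm.norm_map, map_sub, F.symm_apply_apply]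
  · obtain ⟨t, ht⟩ := H.exists_ne (F x)
    refine ⟨t, fun h1 => ht ?_⟩
    rw [happ] at h1
    have h2 := congrArg F h1
    rwa [F.apply_symm_apply] at h2
  · obtain ⟨t, ht⟩ := H.exists_linear_ne
    refine ⟨t, fun h1 => ht ?_⟩
    ext1 x
    have h2 := hlin t (F.symm x)
    rw [h1, F.apply_symm_apply] at h2
    exact (F.symm.injective h2).symm

end IsCircularMotion

theorem Complex.exists_eq_mul_I_mul_conj {f x : ℂ} (hf : f ≠ 0) (hx : (f * x).re = 0) :
    ∃ a : ℝ, x = a * (Complex.I * (starRingEnd ℂ) f) := by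
  refine ⟨(f * x).im / Complex.normSq f, mul_left_cancel₀ hf ?_⟩
  have h1 : f * x = (f * x).im * Complex.I := by
    apply Complex.ext <;> simp [hx]
  have h2 : (Complex.normSq f : ℂ) ≠ 0 := by simpa using hf
  have h3 := Complex.mul_conj f
  rw [Complex.ofReal_div]
  field_simp
  linear_combination (starRingEnd ℂ) f * h1 - x * h3

/-! ### Normal form of the split motion -/

/-- The motion `h` rotates the plane `w = 0` about the points `-b / (p - 1)` and translates the
plane `z = 0`. -/
structure IsSplit (h : ℝ → (E4 ≃ᵃⁱ[ℝ] E4)) (p b d : ℝ → ℂ) : Prop where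
  norm_eq_one : ∀ t, ‖p t‖ = 1
  apply : ∀ t z w, h t (complexPoint z w) = complexPoint (p t * z + b t) (w + d t)

theorem IsCircularMotion.exists_isSplit {h : ℝ → (E4 ≃ᵃⁱ[ℝ] E4)} (H : IsCircularMotion h)
    (hN : ∀ t w, (h t).linearIsometryEquiv (complexPoint 0 w) = complexPoint 0 w) :
    ∃ p b d, IsSplit h p b d := by
  choose p hp hpz using fun t => exists_rotation_of_fixed (H.isDisplacement t) (hN t)
  choose b d hbd using fun t => exists_eq_complexPoint (h t 0)
  refine ⟨p, b, d, hp, fun t z w => ?_⟩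
  have h1 : complexPoint z w = complexPoint z 0 + complexPoint 0 w := by
    rw [complexPoint_add, add_zero, zero_add]
  rw [IsCircularMotion.apply_eq, h1, map_add, hN, hpz, hbd, complexPoint_add, complexPoint_add]
  congr 1 <;> ring

namespace IsSplit

variable {h : ℝ → (E4 ≃ᵃⁱ[ℝ] E4)} {p b d : ℝ → ℂ}

theorem displacement (hs : IsSplit h p b d) (t : ℝ) (z w : ℂ) :
    h t (complexPoint z w) - complexPoint z w = complexPoint ((p t - 1) * z + b t) (d t) := by
  rw [hs.apply, complexPoint_sub, add_sub_cancel_left]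
  congr 1
  ring

theorem linear_displacement (hs : IsSplit h p b d) (t : ℝ) (z : ℂ) :
    (h t).linearIsometryEquiv (complexPoint z 0) - complexPoint z 0 =
      complexPoint ((p t - 1) * z) 0 := by
  have h1 := IsCircularMotion.apply_eq (h t) (complexPoint z 0)
  rw [← complexPoint_zero, hs.apply, hs.apply] at h1
  rw [← sub_eq_iff_eq_add'] at h1
  rw [← h1, complexPoint_sub, complexPoint_sub]
  congr 1 <;> ring

theorem normSq_sub_one (hs : IsSplit h p b d) (t : ℝ) :
    Complex.normSq (p t - 1) = -2 * (p t - 1).re := by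
  have h1 : Complex.normSq (p t) = 1 := by
    rw [Complex.normSq_eq_norm_sq, hs.norm_eq_one, one_pow]
  rw [Complex.normSq_apply] at *
  simp only [Complex.sub_re, Complex.sub_im, Complex.one_re, Complex.one_im]
  linear_combination h1

theorem continuous_p (hs : IsSplit h p b d) (H : IsCircularMotion h) : Continuous p := by
  have h1 : p = fun t => ((h t (complexPoint 1 0) - h t (complexPoint 0 0)).imI : ℂ) +
      ((h t (complexPoint 1 0) - h t (complexPoint 0 0)).imK : ℂ) * Complex.I := by
    ext1 t
    rw [hs.apply, hs.apply, complexPoint_sub, imI_complexPoint, imK_complexPoint,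
      Complex.re_add_im]
    ring
  rw [h1]
  have h2 := (H.continuous (complexPoint 1 0)).sub (H.continuous (complexPoint 0 0))
  have h3 := Quaternion.continuous_imI.comp h2
  have h4 := Quaternion.continuous_imK.comp h2
  exact (Complex.continuous_ofReal.comp h3).add
    ((Complex.continuous_ofReal.comp h4).mul continuous_const)

theorem p_zero (hs : IsSplit h p b d) (H : IsCircularMotion h) : p 0 = 1 := by
  have h1 := hs.linear_displacement 0 1
  rw [H.linear_zero] at h1
  have h2 : complexPoint 0 0 = complexPoint ((p 0 - 1) * 1) 0 := by
    rw [← h1, complexPoint_zero]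
    exact (sub_self _).symm
  have h3 := (complexPoint_inj.1 h2).1
  linear_combination -h3

theorem exists_p_ne (hs : IsSplit h p b d) (H : IsCircularMotion h) : ∃ t, p t ≠ 1 := by
  by_contra! hp
  obtain ⟨t, ht⟩ := H.exists_linear_ne
  apply ht
  ext1 x
  have h1 := IsCircularMotion.apply_eq (h t) x
  obtain ⟨z, w, rfl⟩ := exists_eq_complexPoint x
  rw [← complexPoint_zero, hs.apply, hs.apply, ← sub_eq_iff_eq_add', complexPoint_sub, hp] at h1
  rw [← h1]
  change _ = complexPoint z w
  congr 1 <;> ring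

/-- For `f ≠ 0` the curve `p` would stay on a line and on the unit circle, hence be constant. -/
theorem eq_zero_of_forall_re (hs : IsSplit h p b d) (H : IsCircularMotion h) {f : ℂ}
    (hf : ∀ t, (f * (p t - 1)).re = 0) : f = 0 := by
  by_contra hf0
  obtain ⟨t, ht⟩ := hs.exists_p_ne H
  refine ht ?_
  rw [← hs.p_zero H]
  refine eq_of_continuous_of_line_of_sphere (hs.continuous_p H)
    (v := Complex.I * (starRingEnd ℂ) f) (c := 0) (fun t => ?_) (fun t => ?_) t
  · obtain ⟨a, ha⟩ := Complex.exists_eq_mul_I_mul_conj hf0 (hf t)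
    exact ⟨a, by rw [hs.p_zero H, ha, Complex.real_smul]⟩
  · rw [sub_zero, sub_zero, hs.norm_eq_one, hs.norm_eq_one]

/-- On the unit circle the conjugate of `p` is `p⁻¹`, so twice the relation times `p ^ 2` is a
polynomial equation. It has infinitely many roots, because the range of `p` is connected and
nontrivial, and its constant coefficient is the conjugate of `ν`. -/
theorem eq_zero_of_forall_quadratic (hs : IsSplit h p b d) (H : IsCircularMotion h) {ν μ : ℂ}
    (hν : ∀ t, ((p t - 1) ^ 2 * ν).re = ((p t - 1) * μ).re) : ν = 0 := by
  open Polynomial in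
  let Q : ℂ[X] := C ν * X ^ 2 * (X - 1) ^ 2 + C ((starRingEnd ℂ) ν) * (X - 1) ^ 2 -
    C μ * X ^ 2 * (X - 1) + C ((starRingEnd ℂ) μ) * X * (X - 1)
  have hroot : ∀ t, Q.IsRoot (p t) := by
    intro t
    have hpp : p t * (starRingEnd ℂ) (p t) = 1 := by
      rw [Complex.mul_conj, Complex.normSq_eq_norm_sq, hs.norm_eq_one]
      simp
    have h1 : (p t - 1) ^ 2 * ν + (starRingEnd ℂ) ((p t - 1) ^ 2 * ν) =
        (p t - 1) * μ + (starRingEnd ℂ) ((p t - 1) * μ) := by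
      rw [Complex.add_conj, Complex.add_conj, hν]
    simp only [map_mul, map_pow, map_sub, map_one] at h1
    simp only [Polynomial.IsRoot, Q, Polynomial.eval_add, Polynomial.eval_sub, Polynomial.eval_mul,
      Polynomial.eval_pow, Polynomial.eval_C, Polynomial.eval_X, Polynomial.eval_one]
    linear_combination (p t) ^ 2 * h1 + ((starRingEnd ℂ) ν * (2 * p t - 1 - p t *
      (starRingEnd ℂ) (p t)) + (starRingEnd ℂ) μ * p t) * hpp
  have hinf : (Set.range p).Infinite := by
    refine (isPreconnected_range (hs.continuous_p H)).infinite_of_nontrivial ?_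
    obtain ⟨t, ht⟩ := hs.exists_p_ne H
    exact ⟨p t, ⟨t, rfl⟩, p 0, ⟨0, rfl⟩, by rwa [hs.p_zero H]⟩
  have hQ : Q = 0 := Q.eq_zero_of_infinite_isRoot
    (hinf.mono (by rintro _ ⟨t, rfl⟩; exact hroot t))
  have h0 := congrArg (Polynomial.eval 0) hQ
  simpa [Q] using h0

theorem exists_sphere (hs : IsSplit h p b d) (H : IsCircularMotion h) (z : ℂ) :
    ∃ κ κ' : ℂ, ∀ t, Complex.normSq ((p t - 1) * z + b t) + Complex.normSq (d t) =
      2 * (((p t - 1) * z + b t) * (starRingEnd ℂ) κ + d t * (starRingEnd ℂ) κ').re := by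
  obtain ⟨c, hc⟩ := H.spherical (complexPoint z 0)
  obtain ⟨c₁, c₂, rfl⟩ := exists_eq_complexPoint c
  -- The constants are the centre relative to the moving point `(z, 0)`.
  refine ⟨c₁ - z, c₂, fun t => ?_⟩
  have h1 := congrArg (· ^ 2) (hc t)
  simp only [hs.apply, complexPoint_sub, norm_complexPoint_sq] at h1
  have h2 : p t * z + b t - c₁ = ((p t - 1) * z + b t) - (c₁ - z) := by ring
  have h3 : z - c₁ = -(c₁ - z) := by ring
  rw [h2, h3, zero_add, zero_sub, Complex.normSq_sub _ (c₁ - z), Complex.normSq_sub (d t),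
    Complex.normSq_neg, Complex.normSq_neg] at h1
  rw [Complex.add_re]
  linear_combination h1

/-- A planar motion all of whose points move on circles is a rotation about a fixed point. -/
theorem exists_d_ne_zero (hs : IsSplit h p b d) (H : IsCircularMotion h) : ∃ t, d t ≠ 0 := by
  by_contra! hd
  choose κ κ' hκ using hs.exists_sphere H
  simp only [hd, map_zero, zero_mul, add_zero] at hκ
  -- Here `κ z + z` is the centre for the point `z`. The sphere equation at `0` is subtracted from
  -- the one at `z`; `normSq_sub_one` turns the term in `|p - 1|²` into a linear one.
  have main : ∀ z t, ((p t - 1) * z * (starRingEnd ℂ) (b t)).re + (b t * (starRingEnd ℂ) z).re +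
      (b t * (starRingEnd ℂ) (κ 0)).re =
      (((p t - 1) * z + b t) * (starRingEnd ℂ) (κ z + z)).re := by
    intro z t
    have h0 := hκ 0 t
    have h1 := hκ z t
    have h2 := hs.normSq_sub_one t
    generalize p t - 1 = P at *
    rw [mul_zero, zero_add] at h0
    simp only [Complex.normSq_apply, Complex.add_re, Complex.mul_re, Complex.add_im,
      Complex.mul_im, Complex.conj_re, Complex.conj_im, map_add] at h0 h1 h2 ⊢
    linear_combination h1 / 2 - h0 / 2 - (z.re ^ 2 + z.im ^ 2) / 2 * h2
  have hrel : ∀ z t, (z * (starRingEnd ℂ) ((κ z + z) - (κ (-z) + -z)) * (p t - 1)).re +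
      ((starRingEnd ℂ) ((κ z + z) + (κ (-z) + -z) - 2 * κ 0) * b t).re = 0 := by
    intro z t
    have h1 := main z t
    have h2 := main (-z) t
    generalize p t - 1 = P at *
    generalize κ z + z = c at *
    generalize κ (-z) + -z = c' at *
    simp only [Complex.add_re, Complex.mul_re, Complex.add_im, Complex.sub_re, Complex.sub_im,
      Complex.mul_im, Complex.conj_re, Complex.conj_im, Complex.neg_re, Complex.neg_im,
      Complex.re_ofNat, Complex.im_ofNat] at h1 h2 ⊢
    linear_combination -h1 - h2
  -- If this always vanishes, all centres coincide with `κ 0`, which is then a fixed point.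
  -- Otherwise `hrel` exhibits a point whose trajectory lies on a line. Both are excluded.
  by_cases hcase : ∀ z, (κ z + z) + (κ (-z) + -z) - 2 * κ 0 = 0
  · have hc : ∀ z, κ z + z = κ 0 := by
      intro z
      by_cases hz : z = 0
      · rw [hz, add_zero]
      have h1 : z * (starRingEnd ℂ) ((κ z + z) - (κ (-z) + -z)) = 0 := by
        refine hs.eq_zero_of_forall_re H fun t => ?_
        have := hrel z t
        rw [hcase, map_zero, zero_mul, Complex.zero_re, add_zero] at this
        exact this
      have h2 := (mul_eq_zero.1 h1).resolve_left hz
      rw [map_eq_zero] at h2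
      linear_combination (h2 + hcase z) / 2
    obtain ⟨t, ht⟩ := H.exists_ne (complexPoint (κ 0) 0)
    apply ht
    rw [← sub_eq_zero, hs.displacement, hd, ← complexPoint_zero, complexPoint_inj]
    refine ⟨?_, rfl⟩
    have h1 := main 1 t
    have h2 := main Complex.I t
    rw [hc] at h1 h2
    have hpp : p t * (starRingEnd ℂ) (p t) = 1 := by
      rw [Complex.mul_conj, Complex.normSq_eq_norm_sq, hs.norm_eq_one]
      simp
    have h3 : p t * (starRingEnd ℂ) (b t) = (p t - 1) * (starRingEnd ℂ) (κ 0) := by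
      apply Complex.ext
      · simp at h1 ⊢
        linear_combination h1
      · simp at h2 ⊢
        linear_combination -h2
    have h4 := congrArg (starRingEnd ℂ) h3
    simp only [map_mul, map_sub, map_one, Complex.conj_conj] at h4
    linear_combination p t * h4 + (κ 0 - b t) * hpp
  · push Not at hcase
    obtain ⟨z, hz⟩ := hcase
    set e := (κ z + z) + (κ (-z) + -z) - 2 * κ 0
    set f := z * (starRingEnd ℂ) ((κ z + z) - (κ (-z) + -z))
    have he : (starRingEnd ℂ) e ≠ 0 := by rwa [Ne, map_eq_zero]
    refine H.not_mem_line (complexPoint (f / (starRingEnd ℂ) e) 0)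
      (complexPoint (Complex.I * e) 0) fun t => ?_
    have h1 : ((starRingEnd ℂ) e * ((p t - 1) * (f / (starRingEnd ℂ) e) + b t)).re = 0 := by
      rw [← hrel z t, ← Complex.add_re]
      congr 1
      field_simp
      simp only [f, e]
      ring
    obtain ⟨a, ha⟩ := Complex.exists_eq_mul_I_mul_conj he h1
    rw [Complex.conj_conj] at ha
    exact ⟨a, by rw [hs.displacement, hd, ha, smul_complexPoint, mul_zero]⟩

/-- The translations are real linear functions of the rotation. -/
theorem exists_linear_relation (hs : IsSplit h p b d) (H : IsCircularMotion h) :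
    ∃ t₁ t₂, ∀ t, ∃ x y : ℝ, p t - 1 = x * (p t₁ - 1) + y * (p t₂ - 1) ∧
      b t = x * b t₁ + y * b t₂ ∧ d t = x * d t₁ + y * d t₂ := by
  obtain ⟨t₁, t₂, hli⟩ := H.exists_linearIndependent (complexPoint 0 0)
  refine ⟨t₁, t₂, fun t => ?_⟩
  obtain ⟨x, y, hxy⟩ := Submodule.mem_span_pair.1 (H.mem_span_pair hli t)
  have hcomb := H.linear_comb_mem_span_pair hli hxy.symm
  simp only [hs.displacement, mul_zero, zero_add, smul_complexPoint, complexPoint_add,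
    complexPoint_inj] at hxy
  refine ⟨x, y, ?_, hxy.1.symm, hxy.2.symm⟩
  set e := p t - 1 - x * (p t₁ - 1) - y * (p t₂ - 1) with he
  -- The combination vanishing at the origin acts on the plane `w = 0` as multiplication by `e`. For
  -- `e ≠ 0` its values fill that plane, which must then be the trajectory plane of the origin, so
  -- `d` would vanish identically.
  suffices e = 0 by linear_combination this
  by_contra he0
  have hle : LinearMap.range planeZ.toLinearMap ≤ Submodule.span ℝ
      {h t₁ (complexPoint 0 0) - complexPoint 0 0, h t₂ (complexPoint 0 0) - complexPoint 0 0} := by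
    rintro _ ⟨z, rfl⟩
    change complexPoint z 0 ∈ _
    have h1 := hcomb (complexPoint (z / e) 0)
    simp only [hs.linear_displacement, smul_complexPoint, complexPoint_sub] at h1
    convert h1 using 1
    rw [complexPoint_inj]
    constructor
    · calc z = e * (z / e) := by field_simp
        _ = _ := by rw [he]; ring
    · ring
  have heq := Submodule.eq_of_le_of_finrank_le hle (by
    rw [finrank_range_planeZ]; exact finrank_span_pair_le_two _ _)
  obtain ⟨s, hs'⟩ := hs.exists_d_ne_zero H
  have h2 := H.mem_span_pair hli s
  rw [← heq, hs.displacement] at h2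
  obtain ⟨z, hz⟩ := h2
  exact hs' (complexPoint_inj.1 (show complexPoint z 0 = _ from hz)).2.symm

/-- A real linear map of `ℂ` has the form `P ↦ α P + β P̄`; Cramer's rule finds it from two values.
The determinant is nonzero because `p - 1` is not confined to a real line. -/
theorem exists_coefficients (hs : IsSplit h p b d) (H : IsCircularMotion h) :
    ∃ α β γ δ : ℂ, ∀ t, b t = α * (p t - 1) + β * (starRingEnd ℂ) (p t - 1) ∧
      d t = γ * (p t - 1) + δ * (starRingEnd ℂ) (p t - 1) := by
  obtain ⟨t₁, t₂, hrel⟩ := hs.exists_linear_relation H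
  set P := p t₁ - 1
  set Q := p t₂ - 1
  have hdet : P * (starRingEnd ℂ) Q - (starRingEnd ℂ) P * Q ≠ 0 := by
    intro h0
    have h1 := congrArg Complex.im h0
    simp at h1
    have hP : Complex.I * (starRingEnd ℂ) P = 0 := by
      refine hs.eq_zero_of_forall_re H fun t => ?_
      obtain ⟨x, y, h2, -, -⟩ := hrel t
      rw [h2]
      simp
      linear_combination y / 2 * h1
    have hQ : Complex.I * (starRingEnd ℂ) Q = 0 := by
      refine hs.eq_zero_of_forall_re H fun t => ?_
      obtain ⟨x, y, h2, -, -⟩ := hrel t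
      rw [h2]
      simp
      linear_combination -x / 2 * h1
    have hP' : P = 0 := by simpa using hP
    have hQ' : Q = 0 := by simpa using hQ
    refine one_ne_zero (α := ℂ) (hs.eq_zero_of_forall_re H fun t => ?_)
    obtain ⟨x, y, h2, -, -⟩ := hrel t
    rw [h2, hP', hQ']
    simp
  have key : ∀ u v : ℂ, ∃ α β : ℂ, u = α * P + β * (starRingEnd ℂ) P ∧
      v = α * Q + β * (starRingEnd ℂ) Q := by
    intro u v
    refine ⟨(u * (starRingEnd ℂ) Q - v * (starRingEnd ℂ) P) /
      (P * (starRingEnd ℂ) Q - (starRingEnd ℂ) P * Q),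
      (P * v - Q * u) / (P * (starRingEnd ℂ) Q - (starRingEnd ℂ) P * Q), ?_, ?_⟩ <;>
    · rw [div_mul_eq_mul_div, div_mul_eq_mul_div, ← add_div, eq_div_iff hdet]
      ring
  obtain ⟨α, β, h1, h2⟩ := key (b t₁) (b t₂)
  obtain ⟨γ, δ, h3, h4⟩ := key (d t₁) (d t₂)
  refine ⟨α, β, γ, δ, fun t => ?_⟩
  obtain ⟨x, y, h5, h6, h7⟩ := hrel t
  rw [h6, h7, h5]
  simp only [map_add, map_mul, Complex.conj_ofReal]
  constructor
  · linear_combination x * h1 + y * h2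
  · linear_combination x * h3 + y * h4

theorem exists_normal_form (hs : IsSplit h p b d) (H : IsCircularMotion h) :
    ∃ α γ : ℂ, γ ≠ 0 ∧ (∀ t, b t = α * (p t - 1)) ∧
      ((∀ t, d t = γ * (p t - 1)) ∨ ∀ t, d t = γ * (starRingEnd ℂ) (p t - 1)) := by
  obtain ⟨α, β, γ, δ, hc⟩ := hs.exists_coefficients H
  -- With `P = p - 1`, the point `z - α` is displaced by `(z P + β P̄, γ P + δ P̄)`. In the sphere
  -- equation `|P|² = -2 Re P` is linear, so the coefficient of `P ^ 2` must vanish.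
  have hiso : ∀ z : ℂ, z * (starRingEnd ℂ) β + γ * (starRingEnd ℂ) δ = 0 := by
    intro z
    obtain ⟨κ, κ', hκ⟩ := hs.exists_sphere H (z - α)
    have h2 : (2 : ℂ) * (z * (starRingEnd ℂ) β + γ * (starRingEnd ℂ) δ) = 0 := by
      refine hs.eq_zero_of_forall_quadratic H
        (μ := 2 * (z * (starRingEnd ℂ) κ + (starRingEnd ℂ) β * κ + γ * (starRingEnd ℂ) κ' +
          (starRingEnd ℂ) δ * κ') + 2 * ((Complex.normSq z + Complex.normSq β + Complex.normSq γ +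
          Complex.normSq δ : ℝ) : ℂ)) fun t => ?_
      have h3 := hκ t
      rw [(hc t).1, (hc t).2] at h3
      have h4 := hs.normSq_sub_one t
      generalize p t - 1 = P at *
      have h5 : P * (z - α) + (α * P + β * (starRingEnd ℂ) P) = P * z + β * (starRingEnd ℂ) P := by
        ring
      rw [h5] at h3
      simp only [sq, Complex.normSq_apply, Complex.add_re, Complex.mul_re, Complex.add_im,
        Complex.mul_im, Complex.conj_re, Complex.conj_im, Complex.re_ofNat,
        Complex.im_ofNat, Complex.ofReal_re, Complex.ofReal_im] at h3 h4 ⊢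
      linear_combination h3 - (z.re ^ 2 + z.im ^ 2 + β.re ^ 2 + β.im ^ 2 + γ.re ^ 2 + γ.im ^ 2 +
        δ.re ^ 2 + δ.im ^ 2) * h4
    exact (mul_eq_zero.1 h2).resolve_left two_ne_zero
  have h0 := hiso 0
  have h1 := hiso 1
  rw [zero_mul, zero_add] at h0
  rw [h0, one_mul, add_zero, map_eq_zero] at h1
  simp only [h1, zero_mul, add_zero] at hc
  obtain ⟨s, hs'⟩ := hs.exists_d_ne_zero H
  rcases mul_eq_zero.1 h0 with hγ | hδ
  · simp only [hγ, zero_mul, zero_add] at hc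
    refine ⟨α, δ, ?_, fun t => (hc t).1, Or.inr fun t => (hc t).2⟩
    rintro rfl
    exact hs' (by rw [(hc s).2, zero_mul])
  · rw [map_eq_zero] at hδ
    simp only [hδ, zero_mul, add_zero] at hc
    refine ⟨α, γ, ?_, fun t => (hc t).1, Or.inl fun t => (hc t).2⟩
    rintro rfl
    exact hs' (by rw [(hc s).2, zero_mul])

end IsSplit

/-! ### Realisation by a line-symmetric motion -/

theorem exists_product_isometry (f g : ℂ ≃ₗᵢ[ℝ] ℂ) (z₀ w₀ : ℂ) :
    ∃ φ : E4 ≃ᵃⁱ[ℝ] E4, ∀ z w, φ (complexPoint z w) = complexPoint (f z + z₀) (g w + w₀) := by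
  let A : E4 →ₗᵢ[ℝ] E4 :=
    { toFun := fun x => complexPoint (f ⟨x.imI, x.imK⟩) (g ⟨x.re, x.imJ⟩)
      map_add' := fun x y => by
        rw [complexPoint_add, ← map_add, ← map_add]
        rfl
      map_smul' := fun a x => by
        rw [RingHom.id_apply, smul_complexPoint, ← Complex.real_smul, ← Complex.real_smul,
          ← map_smul, ← map_smul]
        congr 2 <;> apply Complex.ext <;> simp
      norm_map' := fun x => by
        obtain ⟨z, w, rfl⟩ := exists_eq_complexPoint x
        have h : ‖complexPoint (f z) (g w)‖ ^ 2 = ‖complexPoint z w‖ ^ 2 := by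
          rw [norm_complexPoint_sq, norm_complexPoint_sq, Complex.normSq_eq_norm_sq,
            Complex.normSq_eq_norm_sq, Complex.normSq_eq_norm_sq, Complex.normSq_eq_norm_sq,
            f.norm_map, g.norm_map]
        exact (sq_eq_sq₀ (norm_nonneg _) (norm_nonneg _)).1 h }
  refine ⟨(A.toLinearIsometryEquiv rfl).toAffineIsometryEquiv.trans
    (AffineIsometryEquiv.constVAdd ℝ E4 (complexPoint z₀ w₀)), fun z w => ?_⟩
  change complexPoint z₀ w₀ + complexPoint (f z) (g w) = _
  rw [complexPoint_add, add_comm z₀, add_comm w₀]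

/-- Skew lines whose line-symmetric motion, in complex coordinates, consists of the maps
`(z, w) ↦ (p z̄, w̄ - s - s p̄)` with `p` in the unit circle. -/
theorem exists_skew_lines {s : ℝ} (hs : s ≠ 0) :
    ∃ ℓ₁ ℓ₂ : AffineSubspace ℝ E4, IsLineOrthX0 ℓ₁ ∧ IsLineOrthX0 ℓ₂ ∧
      ¬ Coplanar ℝ ((ℓ₁ : Set E4) ∪ (ℓ₂ : Set E4)) ∧
      ∀ p : ℂ, ‖p‖ = 1 → ∃ k ∈ lineSymmetricMotion (rulings ℓ₁ ℓ₂), ∀ z w,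
        k (complexPoint z w) = complexPoint (p * (starRingEnd ℂ) z)
          ((starRingEnd ℂ) w - s - s * (starRingEnd ℂ) p) := by
  have hne : ∀ z : ℂ, z ≠ 0 → complexPoint z 0 ≠ 0 := by
    intro z hz h
    rw [← complexPoint_zero, complexPoint_inj] at h
    exact hz h.1
  -- The directions are `i` and `k`. The first line passes through the point `-s` of the `x₀`-axis,
  -- the second through the origin.
  have h₁ := hasMinimalCoords_mk' (hne 1 one_ne_zero) (re_complexPoint s 0)
  have h₂ := hasMinimalCoords_mk' (hne Complex.I Complex.I_ne_zero) (re_complexPoint 0 0)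
  have horth : ∀ (ℓ : AffineSubspace ℝ E4) (z : ℂ) (m : E4),
      HasMinimalCoords ℓ (complexPoint z 0) m → IsLineOrthX0 ℓ := by
    intro ℓ z m h
    refine ⟨⟨_, h.pedal_mem⟩, ?_, fun v hv => ?_⟩
    · rw [h.2.1]
      exact finrank_span_singleton h.1
    · rw [h.2.1] at hv
      obtain ⟨a, rfl⟩ := Submodule.mem_span_singleton.1 hv
      rw [smul_complexPoint, re_complexPoint]
      simp
  have hpedal₁ : (‖complexPoint 1 0‖ ^ 2)⁻¹ • (complexPoint 1 0 * complexPoint s 0) =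
      complexPoint 0 (-s) := by
    rw [norm_complexPoint_sq]
    ext <;> simp [re_complexPoint, imI_complexPoint, imJ_complexPoint, imK_complexPoint]
  have hpedal₂ : (‖complexPoint Complex.I 0‖ ^ 2)⁻¹ •
      (complexPoint Complex.I 0 * complexPoint 0 0) = complexPoint 0 0 := by
    rw [complexPoint_zero, mul_zero, smul_zero]
  set ℓ₁ := AffineSubspace.mk' ((‖complexPoint 1 0‖ ^ 2)⁻¹ • (complexPoint 1 0 * complexPoint s 0))
    (Submodule.span ℝ {complexPoint 1 0})
  set ℓ₂ := AffineSubspace.mk' ((‖complexPoint Complex.I 0‖ ^ 2)⁻¹ •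
      (complexPoint Complex.I 0 * complexPoint 0 0)) (Submodule.span ℝ {complexPoint Complex.I 0})
  have hp₁ := h₁.pedal_mem
  have hp₂ := h₂.pedal_mem
  rw [hpedal₁] at hp₁
  rw [hpedal₂] at hp₂
  refine ⟨ℓ₁, ℓ₂, horth _ _ _ h₁, horth _ _ _ h₂, fun hcop => ?_, fun p hp => ?_⟩
  · have hdir : ∀ (ℓ : AffineSubspace ℝ E4) (l m : E4), HasMinimalCoords ℓ l m →
        (ℓ : Set E4) ⊆ (ℓ₁ : Set E4) ∪ (ℓ₂ : Set E4) →
        l ∈ vectorSpan ℝ ((ℓ₁ : Set E4) ∪ (ℓ₂ : Set E4)) := by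
      intro ℓ l m h hsub
      refine vectorSpan_mono ℝ hsub ?_
      rw [← AffineSubspace.direction, h.2.1]
      exact Submodule.mem_span_singleton_self _
    have hm₁ := hdir ℓ₁ _ _ h₁ Set.subset_union_left
    have hm₂ := hdir ℓ₂ _ _ h₂ Set.subset_union_right
    have hm₃ := vsub_mem_vectorSpan ℝ (Set.mem_union_left (ℓ₂ : Set E4) hp₁)
      (Set.mem_union_right (ℓ₁ : Set E4) hp₂)
    rw [vsub_eq_sub, complexPoint_sub, sub_zero, sub_zero] at hm₃
    have hcomb : ∀ a b : ℝ, a • complexPoint 1 0 + b • complexPoint Complex.I 0 =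
        complexPoint (a + b * Complex.I) 0 := by
      intro a b
      rw [smul_complexPoint, smul_complexPoint, complexPoint_add]
      congr 1 <;> ring
    have hli : LinearIndependent ℝ ![complexPoint 1 0, complexPoint Complex.I 0] := by
      rw [LinearIndependent.pair_iff]
      intro a b hab
      rw [hcomb, ← complexPoint_zero, complexPoint_inj, Complex.ext_iff] at hab
      simpa using hab.1
    have h3 := mem_span_pair_of_mem hcop.finrank_le_two hli hm₁ hm₂ hm₃
    obtain ⟨a, b, hab⟩ := Submodule.mem_span_pair.1 h3
    rw [hcomb, complexPoint_inj] at hab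
    have := hab.2
    simp at this
    exact hs this
  -- The ruling with direction `(c, 0)` acts with factor `c ^ 2`, so `c` is a square root of `p`.
  · obtain ⟨c, hc⟩ := IsAlgClosed.exists_pow_nat_eq p (n := 2) (by norm_num)
    have hcn : ‖c‖ ^ 2 = 1 := by rw [← norm_pow, hc, hp]
    have hc2 : c.re * c.re + c.im * c.im = 1 := by
      rw [← Complex.normSq_apply, Complex.normSq_eq_norm_sq, hcn]
    have hc0 : c ≠ 0 := by
      rintro rfl
      simp at hcn
    have h := hasMinimalCoords_mk' (hne c hc0) (re_complexPoint (c.re * s) 0)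
    set ℓ := AffineSubspace.mk' ((‖complexPoint c 0‖ ^ 2)⁻¹ •
      (complexPoint c 0 * complexPoint (c.re * s) 0)) (Submodule.span ℝ {complexPoint c 0})
    have hne : Nonempty ℓ := ⟨⟨_, h.pedal_mem⟩⟩
    refine ⟨(EuclideanGeometry.reflection hyperplaneX0).trans (EuclideanGeometry.reflection ℓ),
      ⟨ℓ, ?_, hne, rfl⟩, fun z w => ?_⟩
    · rw [mem_rulings_iff h₁ h₂]
      refine ⟨c.re, c.im, ?_⟩
      rw [smul_complexPoint, smul_complexPoint, smul_complexPoint, smul_complexPoint,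
        complexPoint_add, complexPoint_add]
      convert h using 2 <;> simp
    · rw [h.halfTurn_apply, norm_complexPoint_sq, Complex.normSq_apply, hc2, ← hc]
      ext
      · simp [re_complexPoint, imI_complexPoint, imJ_complexPoint, imK_complexPoint, sq]
        linear_combination (w.re - s) * hc2
      · simp [re_complexPoint, imI_complexPoint, imJ_complexPoint, imK_complexPoint, sq]
        ring
      · simp [re_complexPoint, imI_complexPoint, imJ_complexPoint, imK_complexPoint, sq]
        linear_combination (-w.im) * hc2
      · simp [re_complexPoint, imI_complexPoint, imJ_complexPoint, imK_complexPoint, sq]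
        ring

theorem Complex.exists_isometry_mul {u : ℂ} (hu : ‖u‖ = 1) :
    ∃ σ : ℂ ≃ₗᵢ[ℝ] ℂ, ∀ w, σ w = u * w :=
  ⟨rotation ⟨u, by simpa [Submonoid.unitSphere] using hu⟩, fun w => rotation_apply _ w⟩

/-- Both variants of `d` merge into one by letting `σ` contain a conjugation; this is where frames
of either handedness enter. -/
theorem IsSplit.exists_isometry {h : ℝ → (E4 ≃ᵃⁱ[ℝ] E4)} {p b d : ℝ → ℂ} (hs : IsSplit h p b d)
    (H : IsCircularMotion h) : ∃ (α : ℂ) (s : ℝ) (σ : ℂ ≃ₗᵢ[ℝ] ℂ), s ≠ 0 ∧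
      (∀ t, b t = α * (p t - 1)) ∧ ∀ t, d t = -(s * σ ((starRingEnd ℂ) (p t - 1))) := by
  obtain ⟨α, γ, hγ, hb, hd⟩ := hs.exists_normal_form H
  have hγ' : (‖γ‖ : ℂ) ≠ 0 := by simpa using hγ
  obtain ⟨σ, hσ⟩ := Complex.exists_isometry_mul (u := -γ / ‖γ‖) (by
    rw [norm_div, norm_neg, Complex.norm_real, norm_norm, div_self (norm_ne_zero_iff.2 hγ)])
  rcases hd with hd | hd
  · refine ⟨α, ‖γ‖, Complex.conjLIE.trans σ, norm_ne_zero_iff.2 hγ, hb, fun t => ?_⟩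
    rw [LinearIsometryEquiv.trans_apply, Complex.conjLIE_apply, Complex.conj_conj, hσ, hd]
    field_simp
  · refine ⟨α, ‖γ‖, σ, norm_ne_zero_iff.2 hγ, hb, fun t => ?_⟩
    rw [hσ, hd]
    field_simp

theorem IsCircularMotion.exists_skew_lines {h : ℝ → (E4 ≃ᵃⁱ[ℝ] E4)} (H : IsCircularMotion h) :
    ∃ ℓ₁ ℓ₂ : AffineSubspace ℝ E4, IsLineOrthX0 ℓ₁ ∧ IsLineOrthX0 ℓ₂ ∧
      ¬ Coplanar ℝ ((ℓ₁ : Set E4) ∪ (ℓ₂ : Set E4)) ∧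
      ∃ φ ψ : E4 ≃ᵃⁱ[ℝ] E4, ∀ t, h t ∈ inFrames φ ψ (lineSymmetricMotion (rulings ℓ₁ ℓ₂)) := by
  obtain ⟨N, hN, hfix⟩ := H.exists_fixed_plane
  obtain ⟨F, hF⟩ := exists_isometry_planeW hN
  have H' := H.conj F
  obtain ⟨p, b, d, hs⟩ := H'.exists_isSplit (fun t w => by
    change F.symm ((h t).linearIsometryEquiv (F (complexPoint 0 w))) = complexPoint 0 w
    rw [hfix t _ (hF w), F.symm_apply_apply])
  obtain ⟨α, s, σ, hs0, hb, hd⟩ := hs.exists_isometry H'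
  obtain ⟨ℓ₁, ℓ₂, h₁, h₂, hskew, hk⟩ := _root_.exists_skew_lines hs0
  -- The shifts by `-α` and by the conjugate of `α` produce `b = α (p - 1)`. The shift `σ (2 * s)`
  -- turns `-s - s p̄` into `-s (p̄ - 1)` under `σ`.
  obtain ⟨φ, hφ⟩ := exists_product_isometry (LinearIsometryEquiv.refl ℝ ℂ) σ (-α) (σ (2 * s))
  obtain ⟨ψ, hψ⟩ := exists_product_isometry Complex.conjLIE (σ.symm.trans Complex.conjLIE)
    ((starRingEnd ℂ) α) 0
  refine ⟨ℓ₁, ℓ₂, h₁, h₂, hskew, φ.trans F.toAffineIsometryEquiv,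
    F.symm.toAffineIsometryEquiv.trans ψ, fun t => ?_⟩
  obtain ⟨k, hkm, hkapp⟩ := hk (p t) (hs.norm_eq_one t)
  refine ⟨k, hkm, ?_⟩
  ext1 y
  change F (φ (k (ψ (F.symm y)))) = h t y
  have hconj : ∀ x, F.symm (h t (F x)) = φ (k (ψ x)) := by
    intro x
    obtain ⟨z, w, rfl⟩ := exists_eq_complexPoint x
    have h3 : F.symm (h t (F (complexPoint z w))) = _ := hs.apply t z w
    rw [h3, hψ, hkapp, hφ, complexPoint_inj]
    simp only [LinearIsometryEquiv.trans_apply, Complex.conjLIE_apply, map_add, Complex.conj_conj,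
      LinearIsometryEquiv.coe_refl, id_eq, add_zero]
    constructor
    · rw [hb]
      ring
    · have hreal : ∀ (a : ℝ) (x : ℂ), σ (a * x) = a * σ x := fun a x => by
        rw [← Complex.real_smul, map_smul, Complex.real_smul]
      have h4 := hreal s 1
      have h5 := hreal 2 (s * 1)
      rw [mul_one] at h4 h5
      rw [hd, map_sub, map_sub, map_sub, map_sub, map_one, σ.apply_symm_apply, hreal, h4]
      push_cast at h5
      rw [h5, h4]
      ring
  rw [← hconj, F.apply_symm_apply, F.apply_symm_apply]

theorem isDisplacement_symm_trans {f g : E4 ≃ᵃⁱ[ℝ] E4} (hf : IsDisplacement f)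
    (hg : IsDisplacement g) : IsDisplacement (f.symm.trans g) := by
  have h1 : ((f.symm.trans g).linearIsometryEquiv.toLinearEquiv : E4 →ₗ[ℝ] E4) ∘ₗ
      (f.linearIsometryEquiv.toLinearEquiv : E4 →ₗ[ℝ] E4) =
      (g.linearIsometryEquiv.toLinearEquiv : E4 →ₗ[ℝ] E4) := by
    ext1 x
    change g.linearIsometryEquiv (f.linearIsometryEquiv.symm (f.linearIsometryEquiv x)) = _
    rw [LinearIsometryEquiv.symm_apply_apply]
    rfl
  have h2 := congrArg LinearMap.det h1
  rw [IsDisplacement] at hf hg ⊢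
  rwa [LinearMap.det_comp, hf, hg, mul_one] at h2

/-- A motion that is neither spherical nor a pure translation and moves all points on circles is
part of a line-symmetric motion. -/
theorem exists_subset_lineSymmetricMotion {S : Set (E4 ≃ᵃⁱ[ℝ] E4)} (hS : IsMotion S)
    (hC : ∀ x, ∃ C, IsCircle C ∧ trajectory S x ⊆ C) (hsph : ¬ IsSpherical S)
    (htr : ¬ IsPureTranslation S) :
    ∃ ℓ₁ ℓ₂ : AffineSubspace ℝ E4, IsLineOrthX0 ℓ₁ ∧ IsLineOrthX0 ℓ₂ ∧
      ¬ Coplanar ℝ ((ℓ₁ : Set E4) ∪ (ℓ₂ : Set E4)) ∧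
      ∃ φ ψ : E4 ≃ᵃⁱ[ℝ] E4, S ⊆ inFrames φ ψ (lineSymmetricMotion (rulings ℓ₁ ℓ₂)) := by
  obtain ⟨hdisp, -, G, hG, rfl⟩ := hS
  have hcirc : ∀ y, ∃ (P : AffineSubspace ℝ E4) (c : E4) (r : ℝ),
      Module.finrank ℝ P.direction = 2 ∧ ∀ t, G t y ∈ P ∧ ‖G t y - c‖ = r := by
    intro y
    obtain ⟨_, ⟨P, c, r, hP, -, -, rfl⟩, hsub⟩ := hC y
    refine ⟨P, c, r, hP, fun t => ?_⟩
    obtain ⟨h1, h2⟩ := hsub ⟨G t, ⟨t, rfl⟩, rfl⟩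
    exact ⟨h1, mem_sphere_iff_norm.1 h2⟩
  have H : IsCircularMotion fun t => (G 0).symm.trans (G t) := by
    refine ⟨fun x => hG _, fun x => (G 0).apply_symm_apply x,
      fun t => isDisplacement_symm_trans (hdisp _ ⟨0, rfl⟩) (hdisp _ ⟨t, rfl⟩), fun x => ?_,
      fun x => ?_, fun x => ?_, ?_⟩
    · obtain ⟨P, c, r, hP, h1⟩ := hcirc ((G 0).symm x)
      refine ⟨P.direction, hP.le, fun t => ?_⟩
      have h2 := AffineSubspace.vsub_mem_direction (h1 t).1 (h1 0).1
      rwa [(G 0).apply_symm_apply] at h2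
    · obtain ⟨P, c, r, hP, h1⟩ := hcirc ((G 0).symm x)
      refine ⟨c, fun t => ?_⟩
      have h2 := (h1 0).2
      rw [(G 0).apply_symm_apply] at h2
      rw [h2]
      exact (h1 t).2
    · by_contra! hcon
      refine hsph ⟨(G 0).symm x, x, ?_⟩
      rintro _ ⟨t, rfl⟩
      exact hcon t
    · by_contra! hcon
      have key : ∀ t, (G t).linearIsometryEquiv = (G 0).linearIsometryEquiv := by
        intro t
        ext1 x
        have h1 := congrArg (fun g => g ((G 0).linearIsometryEquiv x)) (hcon t)
        change (G t).linearIsometryEquiv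
          ((G 0).linearIsometryEquiv.symm ((G 0).linearIsometryEquiv x)) = _ at h1
        rw [LinearIsometryEquiv.symm_apply_apply] at h1
        exact h1
      refine htr ?_
      rintro _ ⟨t, rfl⟩ _ ⟨t', rfl⟩
      exact (key t).trans (key t').symm
  obtain ⟨ℓ₁, ℓ₂, h₁, h₂, hskew, φ, ψ, hmem⟩ := H.exists_skew_lines
  refine ⟨ℓ₁, ℓ₂, h₁, h₂, hskew, φ, (G 0).trans ψ, ?_⟩
  rintro _ ⟨t, rfl⟩
  obtain ⟨k, hk, hkt⟩ := hmem t
  refine ⟨k, hk, ?_⟩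
  ext1 x
  have h3 := congrArg (fun g => g (G 0 x)) hkt
  change φ (k (ψ (G 0 x))) = G t ((G 0).symm (G 0 x)) at h3
  rw [AffineIsometryEquiv.symm_apply_apply] at h3
  exact h3

/-! ### Rigidity of circles and the final theorem -/

theorem IsCircle.image {C : Set E4} (hC : IsCircle C) (φ : E4 ≃ᵃⁱ[ℝ] E4) : IsCircle (φ '' C) := by
  obtain ⟨P, c, r, hP, hc, hr, rfl⟩ := hC
  refine ⟨P.map (φ.toAffineEquiv : E4 →ᵃ[ℝ] E4), φ c, r, ?_, ⟨c, hc, rfl⟩, hr, ?_⟩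
  · rw [AffineSubspace.map_direction]
    exact (LinearEquiv.finrank_map_eq φ.linearIsometryEquiv.toLinearEquiv P.direction).trans hP
  · rw [Set.image_inter φ.injective]
    congr 1
    ext y
    rw [mem_sphere_iff_norm]
    constructor
    · rintro ⟨x, hx, rfl⟩
      rwa [← dist_eq_norm, φ.dist_map, dist_eq_norm, ← mem_sphere_iff_norm]
    · intro hy
      refine ⟨φ.symm y, ?_, φ.apply_symm_apply y⟩
      rwa [mem_sphere_iff_norm, ← dist_eq_norm, ← φ.dist_map, φ.apply_symm_apply, dist_eq_norm]

/-- Antipodal points `c ± v` of the smaller set lie in the plane of `C'`, equally far from `c'`. So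
`v` lies in its direction and is orthogonal to `c - c'`; hence planes, centres and radii agree. -/
theorem IsCircle.eq_of_subset {C C' : Set E4} (hC : IsCircle C) (hC' : IsCircle C')
    (hsub : C ⊆ C') (hnt : C.Nontrivial) : C = C' := by
  obtain ⟨P, c, r, hP, hc, hr, rfl⟩ := hC
  obtain ⟨P', c', r', hP', hc', hr', rfl⟩ := hC'
  have hrpos : r ≠ 0 := by
    rintro rfl
    obtain ⟨x, ⟨-, hx⟩, y, ⟨-, hy⟩, hxy⟩ := hnt
    rw [Metric.sphere_zero] at hx hy
    exact hxy (hx.trans hy.symm)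
  have hmem : ∀ v ∈ P.direction, ‖v‖ = r → v + c ∈ P' ∧ ‖v + (c - c')‖ = r' := by
    intro v hv hvr
    obtain ⟨h1, h2⟩ := hsub (⟨AffineSubspace.vadd_mem_of_mem_direction hv hc, by
      rw [mem_sphere_iff_norm, vadd_eq_add, add_sub_cancel_right, hvr]⟩ :
        v +ᵥ c ∈ (P : Set E4) ∩ Metric.sphere c r)
    rw [mem_sphere_iff_norm, vadd_eq_add, add_sub_assoc] at h2
    exact ⟨h1, h2⟩
  have hprop : ∀ v ∈ P.direction, ‖v‖ = r → v ∈ P'.direction ∧ inner ℝ v (c - c') = 0 := by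
    intro v hv hvr
    obtain ⟨h1, h2⟩ := hmem v hv hvr
    obtain ⟨h3, h4⟩ := hmem (-v) (P.direction.neg_mem hv) (by rwa [norm_neg])
    constructor
    · have h5 : v + c - (-v + c) ∈ P'.direction := AffineSubspace.vsub_mem_direction h1 h3
      have h6 := P'.direction.smul_mem (2⁻¹ : ℝ) h5
      convert h6 using 1
      module
    · have h5 : ‖v + (c - c')‖ ^ 2 = ‖-v + (c - c')‖ ^ 2 := by rw [h2, h4]
      rw [norm_add_sq_real, norm_add_sq_real, inner_neg_left, norm_neg] at h5
      linarith
  have hscale : ∀ v ∈ P.direction, v ≠ 0 → v ∈ P'.direction ∧ inner ℝ v (c - c') = 0 := by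
    intro v hv hv0
    have hv0' := norm_ne_zero_iff.2 hv0
    have hne : r / ‖v‖ ≠ 0 := div_ne_zero hrpos hv0'
    obtain ⟨h1, h2⟩ := hprop ((r / ‖v‖) • v) (P.direction.smul_mem _ hv) (by
      rw [norm_smul, norm_div, norm_norm, Real.norm_of_nonneg hr, div_mul_cancel₀ _ hv0'])
    refine ⟨(Submodule.smul_mem_iff _ hne).1 h1, ?_⟩
    rw [inner_smul_left] at h2
    exact (mul_eq_zero.1 h2).resolve_left hne
  have hle : P.direction ≤ P'.direction := by
    intro v hv
    by_cases hv0 : v = 0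
    · rw [hv0]
      exact Submodule.zero_mem _
    · exact (hscale v hv hv0).1
  have hdir := Submodule.eq_of_le_of_finrank_le hle (by rw [hP, hP'])
  obtain ⟨x, ⟨hxP, hxs⟩, -⟩ := hnt
  have hxd : x - c ∈ P.direction := AffineSubspace.vsub_mem_direction hxP hc
  rw [mem_sphere_iff_norm] at hxs
  have hcP' : c ∈ P' := by
    have h1 := AffineSubspace.vadd_mem_of_mem_direction (P'.direction.neg_mem (hle hxd))
      (hmem _ hxd hxs).1
    rwa [vadd_eq_add, neg_add_cancel_left] at h1
  have hcc : c - c' = 0 := by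
    by_contra hne
    have h1 : c - c' ∈ P.direction := by
      rw [hdir]
      exact AffineSubspace.vsub_mem_direction hcP' hc'
    exact hne (inner_self_eq_zero.1 (hscale _ h1 hne).2)
  have hr2 := (hmem _ hxd hxs).2
  rw [hcc, add_zero, hxs] at hr2
  rw [hr2, sub_eq_zero.1 hcc,
    AffineSubspace.ext_of_direction_eq hdir ⟨c, hc, hcP'⟩]

theorem theorem7 :
    (∀ ℓ₁ ℓ₂ : AffineSubspace ℝ E4, IsLineOrthX0 ℓ₁ → IsLineOrthX0 ℓ₂ →
      ¬ Coplanar ℝ ((ℓ₁ : Set E4) ∪ (ℓ₂ : Set E4)) →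
        IsCircularDarboux2Motion (lineSymmetricMotion (rulings ℓ₁ ℓ₂)) ∧
        ¬ IsSpherical (lineSymmetricMotion (rulings ℓ₁ ℓ₂)) ∧
        ¬ IsPureTranslation (lineSymmetricMotion (rulings ℓ₁ ℓ₂))) ∧
    (∀ S : Set (E4 ≃ᵃⁱ[ℝ] E4),
      IsCircularDarboux2Motion S → ¬ IsSpherical S → ¬ IsPureTranslation S →
        ∃ ℓ₁ ℓ₂ : AffineSubspace ℝ E4, IsLineOrthX0 ℓ₁ ∧ IsLineOrthX0 ℓ₂ ∧
          ¬ Coplanar ℝ ((ℓ₁ : Set E4) ∪ (ℓ₂ : Set E4)) ∧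
          ∃ φ ψ : E4 ≃ᵃⁱ[ℝ] E4, S = inFrames φ ψ (lineSymmetricMotion (rulings ℓ₁ ℓ₂))) ∧
    (∀ S : Set (E4 ≃ᵃⁱ[ℝ] E4),
      IsMotion S → (∀ x, ∃ C, IsCircle C ∧ trajectory S x ⊆ C) →
        ¬ IsSpherical S → ¬ IsPureTranslation S →
        ∃ ℓ₁ ℓ₂ : AffineSubspace ℝ E4, IsLineOrthX0 ℓ₁ ∧ IsLineOrthX0 ℓ₂ ∧
          ¬ Coplanar ℝ ((ℓ₁ : Set E4) ∪ (ℓ₂ : Set E4)) ∧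
          ∃ φ ψ : E4 ≃ᵃⁱ[ℝ] E4, S ⊆ inFrames φ ψ (lineSymmetricMotion (rulings ℓ₁ ℓ₂))) := by
  refine ⟨fun ℓ₁ ℓ₂ h₁ h₂ h => ?_, fun S hS hsph htr => ?_,
    fun S hS hC hsph htr => exists_subset_lineSymmetricMotion hS hC hsph htr⟩
  · obtain ⟨l, u, p, q, hform⟩ := exists_isCircularForm h₁ h₂ h
    exact ⟨hform.isCircularDarboux2Motion fun g hg => isDisplacement_of_mem_rulings hg,
      hform.not_isSpherical, hform.not_isPureTranslation⟩
  · obtain ⟨ℓ₁, ℓ₂, h₁, h₂, h, φ, ψ, hsub⟩ :=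
      exists_subset_lineSymmetricMotion hS.1 (fun x => ⟨_, hS.2 x, subset_rfl⟩) hsph htr
    refine ⟨ℓ₁, ℓ₂, h₁, h₂, h, φ, ψ, subset_antisymm hsub ?_⟩
    obtain ⟨l, u, p, q, hform⟩ := exists_isCircularForm h₁ h₂ h
    have hinj : ∀ g ∈ inFrames φ ψ (lineSymmetricMotion (rulings ℓ₁ ℓ₂)),
        ∀ g' ∈ inFrames φ ψ (lineSymmetricMotion (rulings ℓ₁ ℓ₂)), g 0 = g' 0 → g = g' := by
      rintro _ ⟨k, hk, rfl⟩ _ ⟨k', hk', rfl⟩ hkk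
      have : k = k' := hform.eq_of_apply_eq hk hk' (x := ψ 0) (φ.injective hkk)
      rw [this]
    have htraj : trajectory (inFrames φ ψ (lineSymmetricMotion (rulings ℓ₁ ℓ₂))) 0 =
        φ '' trajectory (lineSymmetricMotion (rulings ℓ₁ ℓ₂)) (ψ 0) := by
      rw [trajectory, inFrames, trajectory, Set.image_image, Set.image_image]
      rfl
    -- Comparing the trajectories of the single point `0` suffices, since by `hinj` it determines
    -- the displacements.
    have heq : trajectory S 0 =
        trajectory (inFrames φ ψ (lineSymmetricMotion (rulings ℓ₁ ℓ₂))) 0 := by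
      refine (hS.2 0).eq_of_subset ?_ (Set.image_mono hsub) ?_
      · rw [htraj]
        exact (hform.isCircle_trajectory _).image φ
      · obtain ⟨g, hg, g', hg', hne⟩ := hS.1.2.1
        exact ⟨g 0, ⟨g, hg, rfl⟩, g' 0, ⟨g', hg', rfl⟩,
          fun h0 => hne (hinj g (hsub hg) g' (hsub hg') h0)⟩
    intro g hg
    obtain ⟨g', hg', hgg⟩ : g 0 ∈ trajectory S 0 := heq ▸ ⟨g, hg, rfl⟩
    rw [← hinj g' (hsub hg') g hg hgg]
    exact hg'
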